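/- Let $\Delta$ be a triangle of area one in $\mathbb C$, with side vectors $a\alpha, b\beta, c\gamma$ taken in counterclockwise order ($a,b,c>0$, $|\alpha|=|\beta|=|\gamma|=1$, $a\alpha+b\beta+c\gamma=0$), and let $\lambda\in\mathbb C$ with $|\lambda|=1$. For $(m,n)\in\mathbb Z^2$ put $f(m,n)=(\beta/\gamma)^m(\beta/\alpha)^n$ and $r(m,n)=\Re(\bar\lambda\,\overline{f(m,n)})$. Let $\psi=\psi_{\lambda\Delta}:\mathbb Z^2\to\mathbb C$ be the unique function with $\psi(0,0)=0$ and, for all $m,n$, $$\psi(m+1,n)-\psi(m,n)=a\alpha\,\lambda f(m,n)\,r(m,n),\qquad \psi(m,n+1)-\psi(m+1,n)=b\beta\,\lambda f(m,n)\,r(m,n),$$ $$\psi(m,n)-\psi(m,n+1)=c\gamma\,\lambda f(m,n)\,r(m,n).$$ The vertices of the T-graph $T_{\lambda\Delta}$ are the points of $\psi(\mathbb Z^2)$. Its faces are the triangles with corners $\psi(m,n),\psi(m+1,n),\psi(m,n+1)$. Its segments are the convex hulls of the (collinear) triples $\psi(m,n),\psi(m+1,n),\psi(m+1,n-1)$,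 for $(m,n)\in\mathbb Z^2$. The T-graph is non-degenerate if no face is reduced to a point and every segment has a vertex in its interior; then every vertex is in the interior of exactly one segment. The random walk $(X_t)_{t\ge0}$ on a non-degenerate $T_{\lambda\Delta}$ is the continuous-time Markov process on its vertices that, from a vertex $v$ in the interior of the segment with endpoints $v^+,v^-$, jumps to $v^{\pm}$ at rate $1/|v^\pm-v|$. **Proposition.** There is a continuous function $\Delta\mapsto\epsilon(\Delta)>0$ on the space of triangles of area one (given by their side vectors) such that the following holds for every $\Delta$, every $\lambda$ of modulus one for which $T_{\lambda\Delta}$ is non-degenerate, and every vertex $x_0$ of $T_{\lambda\Delta}$. The random walk started at $x_0$ almost surely makes only finitely many jumps before time $1$, and for every unit vector $\mathbf n\in\mathbb S^1$ the variable $X_1\cdot\mathbf n$ is square integrable with $$\epsilon(\Delta)<\operatorname{Var}(X_1\cdot\mathbf n)<\frac1{\epsilon(\Delta)} .$$ -/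

import Mathlib

open MeasureTheory ProbabilityTheory
open scoped ENNReal ComplexConjugate

namespace TGraph

noncomputable section

/-! ### Triangles -/

/-- A triangle of area one in the complex plane (up to translation), given by its three side
vectors taken in counterclockwise order. The side vectors sum to zero, and twice the signed
area is `Im (conj A * B)` for consecutive sides `A`, `B`; it is positive exactly when the order is
counterclockwise. The topology is the one induced from `ℂ × ℂ × ℂ`. -/
abbrev UnitTriangle : Type :=
  {s : ℂ × ℂ × ℂ // s.1 + s.2.1 + s.2.2 = 0 ∧ (conj s.1 * s.2.1).im = 2}

/-- The three kinds of edges of the hexagonal lattice. -/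
inductive EdgeKind
  | vertical
  | nesw
  | nwse

/-- The side vectors `a α`, `b β`, `c γ` of the triangle, attached to the vertical, NE-SW and
NW-SE edges respectively. -/
def side (Δ : UnitTriangle) : EdgeKind → ℂ
  | .vertical => Δ.1.1
  | .nesw => Δ.1.2.1
  | .nwse => Δ.1.2.2

/-- The side lengths `a`, `b`, `c`: the weight `K` of an edge of the given kind. -/
def len (Δ : UnitTriangle) (e : EdgeKind) : ℝ := ‖side Δ e‖

/-- The side directions `α`, `β`, `γ`, of modulus one. -/
def dir (Δ : UnitTriangle) (e : EdgeKind) : ℂ := side Δ e / (len Δ e : ℂ)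

/-! ### The hexagonal lattice and the flow

White vertices `w(m,n)`, black vertices `b(m,n)` and vertices `v(m,n)` of the dual triangular
lattice (the hexagons) are all indexed by `ℤ × ℤ`. The edge between `w(m,n)` and `b(m,n)` is
vertical, with the white vertex on top, and `v(m,n)` is the hexagon just left of it. -/

/-- The black endpoint of the edge of given kind at the white vertex `w`. -/
def blackEnd : EdgeKind → ℤ × ℤ → ℤ × ℤ
  | .vertical, w => (w.1, w.2)
  | .nesw, w => (w.1, w.2 + 1)
  | .nwse, w => (w.1 - 1, w.2 + 1)

/-- `f(w(m,n)) = (β/γ)^m (β/α)^n`. -/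
def f (Δ : UnitTriangle) (w : ℤ × ℤ) : ℂ :=
  (dir Δ .nesw / dir Δ .nwse) ^ w.1 * (dir Δ .nesw / dir Δ .vertical) ^ w.2

/-- `g(b(m,n)) = α (β/γ)^m (β/α)^n`. -/
def g (Δ : UnitTriangle) (b : ℤ × ℤ) : ℂ :=
  dir Δ .vertical *
    ((dir Δ .nesw / dir Δ .nwse) ^ b.1 * (dir Δ .nesw / dir Δ .vertical) ^ b.2)

/-- The flow `φ(wb) = K(w,b) Re(conj λ * conj f(w)) λ g(b)` along the edge of given kind at the
white vertex `w`, oriented from white to black. -/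
def flow (Δ : UnitTriangle) (lam : Circle) (w : ℤ × ℤ) (e : EdgeKind) : ℂ :=
  (len Δ e : ℂ) * (((conj (lam : ℂ) * conj (f Δ w)).re : ℝ) : ℂ) *
    ((lam : ℂ) * g Δ (blackEnd e w))

/-- `u 0 + ⋯ + u (k - 1)` for `k ≥ 0` and `-(u k + ⋯ + u (-1))` for `k < 0`. -/
def signedSum (u : ℤ → ℂ) (k : ℤ) : ℂ :=
  ∑ j ∈ Finset.Ico 0 k, u j - ∑ j ∈ Finset.Ico k 0, u j

/-- The primitive `ψ` of the dual flow on the vertices of the dual lattice, with `ψ(v(0,0)) = 0`,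
obtained by summing from `v(0,0)` to `v(m,0)` and then to `v(m,n)`. By `psi_right`, `psi_up` and
`psi_diag` below, its increment across every edge is the flow through that edge, counted
positively when the white endpoint is on the left. -/
def psi (Δ : UnitTriangle) (lam : Circle) (v : ℤ × ℤ) : ℂ :=
  signedSum (fun j => flow Δ lam (j, 0) .vertical) v.1 -
    signedSum (fun j => flow Δ lam (v.1, j) .nwse) v.2

theorem signedSum_zero (u : ℤ → ℂ) : signedSum u 0 = 0 := by
  simp [signedSum]

theorem signedSum_succ (u : ℤ → ℂ) (k : ℤ) :
    signedSum u (k + 1) = signedSum u k + u k := by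
  unfold signedSum
  rcases le_or_gt 0 k with h | h
  · have h1 : Finset.Ico 0 (k + 1) = insert k (Finset.Ico 0 k) := by
      ext j; simp only [Finset.mem_Ico, Finset.mem_insert]; omega
    have h2 : Finset.Ico k 0 = ∅ := by
      ext j; simp only [Finset.mem_Ico, Finset.notMem_empty, iff_false]; omega
    have h3 : Finset.Ico (k + 1) 0 = ∅ := by
      ext j; simp only [Finset.mem_Ico, Finset.notMem_empty, iff_false]; omega
    rw [h1, h2, h3, Finset.sum_insert (by simp)]
    simp only [Finset.sum_empty]; ring
  · have h1 : Finset.Ico k 0 = insert k (Finset.Ico (k + 1) 0) := by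
      ext j; simp only [Finset.mem_Ico, Finset.mem_insert]; omega
    have h2 : Finset.Ico 0 k = ∅ := by
      ext j; simp only [Finset.mem_Ico, Finset.notMem_empty, iff_false]; omega
    have h3 : Finset.Ico 0 (k + 1) = ∅ := by
      ext j; simp only [Finset.mem_Ico, Finset.notMem_empty, iff_false]; omega
    rw [h1, h2, h3, Finset.sum_insert (by simp)]
    simp only [Finset.sum_empty]; ring

theorem side_ne_zero (Δ : UnitTriangle) (e : EdgeKind) : side Δ e ≠ 0 := by
  obtain ⟨⟨A, B, C⟩, h1, h2⟩ := Δ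
  have h1' : A + B + C = 0 := h1
  have h2' : (conj A * B).im = 2 := h2
  cases e
  · intro h
    have : A = 0 := h
    rw [this] at h2'; norm_num at h2'
  · intro h
    have : B = 0 := h
    rw [this] at h2'; norm_num at h2'
  · intro h
    have h3 : C = 0 := h
    have h4 : B = -A := by rw [h3, add_zero] at h1'; exact eq_neg_of_add_eq_zero_right h1'
    rw [h4] at h2'
    simp only [Complex.mul_im, Complex.conj_re, Complex.conj_im, Complex.neg_im,
      Complex.neg_re] at h2'
    nlinarith

theorem len_ne_zero (Δ : UnitTriangle) (e : EdgeKind) : (len Δ e : ℂ) ≠ 0 := by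
  simpa [len] using side_ne_zero Δ e

theorem dir_ne_zero (Δ : UnitTriangle) (e : EdgeKind) : dir Δ e ≠ 0 :=
  div_ne_zero (side_ne_zero Δ e) (len_ne_zero Δ e)

theorem conj_dir (Δ : UnitTriangle) (e : EdgeKind) : conj (dir Δ e) = (dir Δ e)⁻¹ := by
  have h : ‖dir Δ e‖ = 1 := by
    have := len_ne_zero Δ e
    rw [dir, norm_div, Complex.norm_real, len, norm_norm]
    exact div_self (norm_ne_zero_iff.2 (side_ne_zero Δ e))
  rw [Complex.inv_def, Complex.normSq_eq_norm_sq, h]; simp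

theorem len_mul_dir (Δ : UnitTriangle) (e : EdgeKind) : (len Δ e : ℂ) * dir Δ e = side Δ e :=
  mul_div_cancel₀ _ (len_ne_zero Δ e)

theorem side_sum (Δ : UnitTriangle) :
    side Δ .vertical + side Δ .nesw + side Δ .nwse = 0 := Δ.2.1

/-- The flow has zero divergence at white vertices. -/
theorem flow_white (Δ : UnitTriangle) (lam : Circle) (w : ℤ × ℤ) :
    flow Δ lam w .vertical + flow Δ lam w .nesw + flow Δ lam w .nwse = 0 := by
  have h := side_sum Δ
  rw [← len_mul_dir, ← len_mul_dir, ← len_mul_dir] at h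
  have ha := dir_ne_zero Δ .vertical
  have hb := dir_ne_zero Δ .nesw
  have hc := dir_ne_zero Δ .nwse
  simp only [flow, g, blackEnd]
  rw [zpow_add₀ (div_ne_zero hb ha), zpow_sub₀ (div_ne_zero hb hc), zpow_one, zpow_one]
  set r : ℂ := (((conj (lam : ℂ) * conj (f Δ w)).re : ℝ) : ℂ)
  set P := (dir Δ .nesw / dir Δ .nwse) ^ w.1
  set Q := (dir Δ .nesw / dir Δ .vertical) ^ w.2
  have e1 : dir Δ .vertical * (P * (Q * (dir Δ .nesw / dir Δ .vertical))) =
      dir Δ .nesw * (P * Q) := by field_simp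
  have e2 : dir Δ .vertical *
      (P / (dir Δ .nesw / dir Δ .nwse) * (Q * (dir Δ .nesw / dir Δ .vertical))) =
      dir Δ .nwse * (P * Q) := by field_simp
  rw [e1, e2]
  linear_combination (r * (lam : ℂ) * (P * Q)) * h

/-- The flow has zero divergence at black vertices. -/
theorem flow_black (Δ : UnitTriangle) (lam : Circle) (m n : ℤ) :
    flow Δ lam (m, n + 1) .vertical + flow Δ lam (m, n) .nesw +
      flow Δ lam (m + 1, n) .nwse = 0 := by
  have h := congrArg conj (side_sum Δ)
  rw [← len_mul_dir, ← len_mul_dir, ← len_mul_dir] at h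
  simp only [map_add, map_mul, conj_dir, Complex.conj_ofReal, map_zero] at h
  have ha := dir_ne_zero Δ .vertical
  have hb := dir_ne_zero Δ .nesw
  have hc := dir_ne_zero Δ .nwse
  have key : (len Δ .vertical : ℂ) * f Δ (m, n + 1) + (len Δ .nesw : ℂ) * f Δ (m, n) +
      (len Δ .nwse : ℂ) * f Δ (m + 1, n) = 0 := by
    simp only [f]
    rw [zpow_add₀ (div_ne_zero hb ha), zpow_add₀ (div_ne_zero hb hc), zpow_one, zpow_one]
    set P := (dir Δ .nesw / dir Δ .nwse) ^ m
    set Q := (dir Δ .nesw / dir Δ .vertical) ^ n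
    have := congrArg (fun z => dir Δ .nesw * P * Q * z) h
    simp only [mul_zero] at this
    rw [← this]
    field_simp
  have key' := congrArg (fun z : ℂ => (conj (lam : ℂ) * conj z).re) key
  simp only [map_add, map_mul, Complex.conj_ofReal, map_zero, mul_zero, Complex.zero_re] at key'
  have key2 : len Δ .vertical * (conj (lam : ℂ) * conj (f Δ (m, n + 1))).re +
      len Δ .nesw * (conj (lam : ℂ) * conj (f Δ (m, n))).re +
      len Δ .nwse * (conj (lam : ℂ) * conj (f Δ (m + 1, n))).re = 0 := by
    rw [← key', mul_add, mul_add, Complex.add_re, Complex.add_re,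
      mul_left_comm _ ((len Δ .vertical : ℝ) : ℂ), mul_left_comm _ ((len Δ .nesw : ℝ) : ℂ),
      mul_left_comm _ ((len Δ .nwse : ℝ) : ℂ), Complex.re_ofReal_mul, Complex.re_ofReal_mul,
      Complex.re_ofReal_mul]
  have key3 := congrArg (fun x : ℝ => (x : ℂ)) key2
  push_cast at key3
  simp only [flow, blackEnd, add_sub_cancel_right]
  linear_combination ((lam : ℂ) * g Δ (m, n + 1)) * key3

theorem psi_zero (Δ : UnitTriangle) (lam : Circle) : psi Δ lam (0, 0) = 0 := by
  simp [psi, signedSum_zero]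

/-- Crossing the NW-SE edge at `w(m,n)` upwards, the white endpoint is on the right. -/
theorem psi_up (Δ : UnitTriangle) (lam : Circle) (m n : ℤ) :
    psi Δ lam (m, n + 1) - psi Δ lam (m, n) = -flow Δ lam (m, n) .nwse := by
  simp only [psi, signedSum_succ]; ring

/-- Crossing the vertical edge at `w(m,n)` to the right, the white endpoint is on the left. -/
theorem psi_right (Δ : UnitTriangle) (lam : Circle) (m n : ℤ) :
    psi Δ lam (m + 1, n) - psi Δ lam (m, n) = flow Δ lam (m, n) .vertical := by
  have step : ∀ k : ℤ, flow Δ lam (m, k + 1) .vertical - flow Δ lam (m, k) .vertical =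
      flow Δ lam (m, k) .nwse - flow Δ lam (m + 1, k) .nwse := fun k => by
    linear_combination flow_black Δ lam m k - flow_white Δ lam (m, k)
  induction n using Int.induction_on with
  | zero => simp only [psi, signedSum_zero, signedSum_succ]; ring
  | succ k ih =>
    linear_combination ih + psi_up Δ lam (m + 1) k - psi_up Δ lam m k - step k
  | pred k ih =>
    have h1 := psi_up Δ lam (m + 1) (-(k : ℤ) - 1)
    have h2 := psi_up Δ lam m (-(k : ℤ) - 1)
    have h3 := step (-(k : ℤ) - 1)
    rw [sub_add_cancel] at h1 h2 h3
    linear_combination ih - h1 + h2 + h3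

/-- Crossing the NE-SW edge at `w(m,n)` from right to left, the white endpoint is on the left. -/
theorem psi_diag (Δ : UnitTriangle) (lam : Circle) (m n : ℤ) :
    psi Δ lam (m, n + 1) - psi Δ lam (m + 1, n) = flow Δ lam (m, n) .nesw := by
  linear_combination psi_up Δ lam m n - psi_right Δ lam m n - flow_white Δ lam (m, n)

/-! ### The T-graph -/

/-- The vertices of the T-graph, as a set of points of the plane. -/
def vertexSet (Δ : UnitTriangle) (lam : Circle) : Set ℂ := Set.range (psi Δ lam)

/-- The image of the white face of the dual lattice around `w(m,n)`, whose corners are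
`v(m,n)`, `v(m+1,n)`, `v(m,n+1)`: a triangle, called a face of the T-graph. -/
def face (Δ : UnitTriangle) (lam : Circle) (w : ℤ × ℤ) : Set ℂ :=
  convexHull ℝ {psi Δ lam (w.1, w.2), psi Δ lam (w.1 + 1, w.2), psi Δ lam (w.1, w.2 + 1)}

/-- The image of the black face of the dual lattice around `b(m,n)`, whose corners are
`v(m,n)`, `v(m+1,n)`, `v(m+1,n-1)`. The three image points are collinear, so that this is a
segment, called a segment of the T-graph. -/
def seg (Δ : UnitTriangle) (lam : Circle) (b : ℤ × ℤ) : Set ℂ :=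
  convexHull ℝ {psi Δ lam (b.1, b.2), psi Δ lam (b.1 + 1, b.2), psi Δ lam (b.1 + 1, b.2 - 1)}

/-- The segment of the T-graph attached to `b` has the two endpoints `x` and `y`, and `v` lies in
its interior. -/
def IsInterior (Δ : UnitTriangle) (lam : Circle) (b : ℤ × ℤ) (x y v : ℂ) : Prop :=
  x ≠ y ∧ seg Δ lam b = segment ℝ x y ∧ v ∈ openSegment ℝ x y

/-- The T-graph is non-degenerate: no face is reduced to a point, and every segment has a vertex
of the T-graph in its interior. -/
def Nondegenerate (Δ : UnitTriangle) (lam : Circle) : Prop :=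
  (∀ w : ℤ × ℤ, ¬ (face Δ lam w).Subsingleton) ∧
    ∀ b : ℤ × ℤ, ∃ x y, ∃ v ∈ vertexSet Δ lam, IsInterior Δ lam b x y v

/-! ### Continuous-time Markov chains given by their jump rates -/

section MarkovChain

variable {V : Type*}

/-- The total jump rate out of `x`. -/
def exitRate (q : V → V → ℝ) (x : V) : ℝ := ∑' z, q x z

open Classical in
/-- For the continuous-time Markov chain with jump rates `q` started at `x`, the probability that
it has made exactly `k` jumps by time `t` and is at `y` at time `t`. The chain waits at `x` an
exponential time of parameter `exitRate q x` and then jumps to `z` with probability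
`q x z / exitRate q x`; so the time of the first jump, together with the event that the
jump goes to `z`, has density `exp (-s * exitRate q x) * q x z`. -/
def jumpProb (q : V → V → ℝ) : ℕ → ℝ → V → V → ℝ≥0∞
  | 0, t, x, y => if x = y then ENNReal.ofReal (Real.exp (-(t * exitRate q x))) else 0
  | k + 1, t, x, y =>
      ∫⁻ s in Set.Icc 0 t, ENNReal.ofReal (Real.exp (-(s * exitRate q x))) *
        ∑' z, ENNReal.ofReal (q x z) * jumpProb q k (t - s) z y

/-- The transition function `p_t(x,y)` of the (minimal) continuous-time Markov chain with jump
rates `q`: the probability to be at `y` at time `t`, after finitely many jumps, when started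
at `x`. The chain does not explode if and only if `p_t(x,·)` has total mass one for all `t`
and `x`. -/
def transitionProb (q : V → V → ℝ) (t : ℝ) (x y : V) : ℝ≥0∞ :=
  ∑' k, jumpProb q k t x y

end MarkovChain

/-! ### The random walk on the T-graph -/

open Classical in
/-- The jump rates of the random walk: from a vertex `v`, contained in the interior of a segment
of the T-graph, jump to each endpoint `v'` of this segment at rate `1 / ‖v' - v‖`. -/
def walkRate (Δ : UnitTriangle) (lam : Circle) (v v' : vertexSet Δ lam) : ℝ :=
  if ∃ (b : ℤ × ℤ) (y : ℂ), IsInterior Δ lam b v' y v then 1 / ‖(v' : ℂ) - (v : ℂ)‖ else 0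

/-- The law, on the plane, of the position `X_t` at time `t` of the random walk on the T-graph
started at the vertex `x₀`. -/
def walkLaw (Δ : UnitTriangle) (lam : Circle) (x₀ : vertexSet Δ lam) (t : ℝ) : Measure ℂ :=
  Measure.sum fun y : vertexSet Δ lam =>
    transitionProb (walkRate Δ lam) t x₀ y • Measure.dirac (y : ℂ)

end

end TGraph

/-!
The walk is a martingale whose variance along `n` grows at rate `|s| (n · u)²`, where `s` is the
segment containing the current vertex in its interior and `u` is its direction. The proof consists
in showing that the walk is well defined and does not explode, and that this rate is bounded on
average from above and from below. All constants depend only on an upper bound `D` for the side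
lengths of the triangle, since the area is fixed; a partition of unity then produces a continuous
function of the triangle.

**Every vertex is in the interior of exactly one segment.** Locally, the contraction ratios of the
three faces at a vertex have a vanishing positive combination (`sum_len_mul_ratio`), so that exactly
two of them have the same sign; the vertex lies between its neighbours on the segment adjacent to
these two faces. The global statement needs that the faces do not overlap. Here `2 ψ` is the sum of
a linear map `L` and a map `S` with values in a circle (`two_mul_psi`), and
`|S z - S z'| ≤ |L z - L z'|`, with equality only if `z` and `z'` are equal or
neighbours (`defect_pos_or`). Indeed the defect
`|L|² - |S|²` vanishes on neighbours and exceeds the parallelogram law, so it is positive elsewhere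
by climbing along Euclid's algorithm (`pos_of_mem_sector`). Hence `ψ` is injective (`psi_injective`)
and a vertex in the interior of a segment is the middle one of the three vertices defining it
(`eq_of_mem_openSegment`).

**Non-explosion and the upper bound.** The function `(1 + |x - x₀|²)²` is a Lyapunov function,
because the lengths of the segments are bounded, and it has finite sublevel sets on the vertices.
This bounds the second moments (`tsum_transitionProb_mul_le`) and yields a comparison principle for
subsolutions of the backward equation of at most quadratic growth (`subsolution_le_tsum`), although
the jump rates are not bounded. Non-explosion is the comparison with the constant one.

**The lower bound.** By the comparison principle it suffices to exhibit a bounded function `φ ≥ 1`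
with `μ φ ≤ 𝓛 φ + C (n · u)²`, for a `μ` such that `exp μ` exceeds the supremum of `φ`: then
`(x · n - y)² + θ (exp (μ t) φ - sup φ)` is a subsolution for small `θ`. Consecutive segments are
transversal, so the walk cannot move on segments orthogonal to `n` only; but it could leave the
others much faster. This happens only near a face of small contraction ratio, and there the walk
turns around the face many times, spending comparable times at its three corners. The function
`SegmentWalk.test` takes both effects into account. Its supremum is quadratic in `μ`, which is
beaten by `exp μ`.
-/

namespace TGraph

/-! ### Comparison principles for Markov chains -/

section MarkovChain

variable {V : Type*}

theorem measurable_jumpProb [Countable V] (q : V → V → ℝ) (k : ℕ) :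
    ∀ x y, Measurable fun t => jumpProb q k t x y := by
  induction k with
  | zero =>
    intro x y
    simp only [jumpProb]
    split_ifs
    · fun_prop
    · exact measurable_const
  | succ k ih =>
    intro x y
    have h : ∀ t, jumpProb q (k + 1) t x y = ∫⁻ s, Set.indicator {p : ℝ × ℝ | 0 ≤ p.2 ∧ p.2 ≤ p.1}
        (fun p => ENNReal.ofReal (Real.exp (-(p.2 * exitRate q x))) *
          ∑' z, ENNReal.ofReal (q x z) * jumpProb q k (p.1 - p.2) z y) (t, s) := by
      intro t
      simp only [jumpProb]
      rw [← lintegral_indicator measurableSet_Icc]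
      rfl
    simp_rw [h]
    refine Measurable.lintegral_prod_right' (ν := volume) (f := _) ?_
    refine Measurable.indicator ?_ ?_
    · refine Measurable.mul (by fun_prop) (Measurable.tsum fun z => ?_)
      exact Measurable.const_mul ((ih z y).comp (by fun_prop)) _
    · exact (measurableSet_le measurable_const measurable_snd).inter
        (measurableSet_le measurable_snd measurable_fst)

/-- The expectation of `h` at the position at time `t` of the chain started at `x`, on the event
that it has made fewer than `n` jumps by then. -/
noncomputable def expectBefore (q : V → V → ℝ) (h : V → ℝ≥0∞) (n : ℕ) (t : ℝ) (x : V) : ℝ≥0∞ :=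
  ∑ k ∈ Finset.range n, ∑' y, jumpProb q k t x y * h y

theorem measurable_tsum_jumpProb_mul [Countable V] (q : V → V → ℝ) (h : V → ℝ≥0∞) (k : ℕ) (x : V) :
    Measurable fun t => ∑' y, jumpProb q k t x y * h y :=
  Measurable.tsum fun y => (measurable_jumpProb q k x y).mul_const _

theorem measurable_expectBefore [Countable V] (q : V → V → ℝ) (h : V → ℝ≥0∞) (n : ℕ) (x : V) :
    Measurable fun t => expectBefore q h n t x :=
  Finset.measurable_fun_sum _ fun k _ => measurable_tsum_jumpProb_mul q h k x

theorem tsum_jumpProb_succ_mul [Countable V] (q : V → V → ℝ) (h : V → ℝ≥0∞) (k : ℕ) (t : ℝ)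
    (x : V) :
    ∑' y, jumpProb q (k + 1) t x y * h y =
      ∫⁻ s in Set.Icc 0 t, ENNReal.ofReal (Real.exp (-(s * exitRate q x))) *
        ∑' z, ENNReal.ofReal (q x z) * ∑' y, jumpProb q k (t - s) z y * h y := by
  have hm : ∀ z y, Measurable fun s => jumpProb q k (t - s) z y := fun z y =>
    (measurable_jumpProb q k z y).comp (by fun_prop)
  have hm' : ∀ y, Measurable fun s => ENNReal.ofReal (Real.exp (-(s * exitRate q x))) *
      ∑' z, ENNReal.ofReal (q x z) * jumpProb q k (t - s) z y := fun y =>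
    Measurable.mul (by fun_prop) (Measurable.tsum fun z => (hm z y).const_mul _)
  simp only [jumpProb]
  simp_rw [← lintegral_mul_const _ (hm' _)]
  rw [← lintegral_tsum fun y => ((hm' y).mul_const _).aemeasurable]
  refine lintegral_congr fun s => ?_
  simp_rw [mul_assoc, ENNReal.tsum_mul_left, ← ENNReal.tsum_mul_right, ← ENNReal.tsum_mul_left]
  rw [ENNReal.tsum_comm]
  simp_rw [mul_assoc]

/-- Decomposition at the first jump. -/
theorem expectBefore_succ [Countable V] (q : V → V → ℝ) (h : V → ℝ≥0∞) (n : ℕ) (t : ℝ) (x : V) :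
    expectBefore q h (n + 1) t x = ENNReal.ofReal (Real.exp (-(t * exitRate q x))) * h x +
      ∫⁻ s in Set.Icc 0 t, ENNReal.ofReal (Real.exp (-(s * exitRate q x))) *
        ∑' z, ENNReal.ofReal (q x z) * expectBefore q h n (t - s) z := by
  classical
  unfold expectBefore
  rw [Finset.sum_range_succ', add_comm]
  congr 1
  · simp only [jumpProb]
    rw [tsum_eq_single x]
    · simp
    · intro y hy
      simp [hy.symm]
  · simp_rw [tsum_jumpProb_succ_mul]
    rw [← lintegral_finsetSum]
    · refine lintegral_congr fun s => ?_
      simp_rw [Finset.mul_sum]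
      rw [← Finset.mul_sum, Summable.tsum_finsetSum fun _ _ => ENNReal.summable]
    · intro k _
      refine Measurable.mul (by fun_prop) (Measurable.tsum fun z => ?_)
      exact Measurable.const_mul ((measurable_tsum_jumpProb_mul q h k z).comp (by fun_prop)) _

/-- Variation of constants for the function `a + b e ^ (c t)`. -/
theorem integral_exp_mul_barrier (Q a b c t : ℝ) :
    ∫ s in (0 : ℝ)..t, Real.exp (-(s * Q)) *
        (Q * (a + b * Real.exp (c * (t - s))) + b * c * Real.exp (c * (t - s))) =
      a + b * Real.exp (c * t) - Real.exp (-(t * Q)) * (a + b) := by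
  have hd : ∀ s ∈ Set.uIcc 0 t, HasDerivAt
      (fun s => -(Real.exp (-(s * Q)) * (a + b * Real.exp (c * (t - s)))))
      (Real.exp (-(s * Q)) *
        (Q * (a + b * Real.exp (c * (t - s))) + b * c * Real.exp (c * (t - s)))) s := by
    intro s _
    have h1 : HasDerivAt (fun s : ℝ => Real.exp (-(s * Q))) (Real.exp (-(s * Q)) * -(1 * Q)) s :=
      ((hasDerivAt_id s).mul_const Q).neg.exp
    have h2 : HasDerivAt (fun s : ℝ => a + b * Real.exp (c * (t - s)))
        (b * (Real.exp (c * (t - s)) * (c * (-1)))) s :=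
      ((((hasDerivAt_id s).const_sub t).const_mul c).exp.const_mul b).const_add a
    refine (h1.mul h2).neg.congr_deriv ?_
    ring
  rw [intervalIntegral.integral_eq_sub_of_hasDerivAt hd]
  · simp
    ring
  · exact Continuous.intervalIntegrable (by fun_prop) _ _

theorem lintegral_Icc_ofReal_eq {g : ℝ → ℝ} (hg : Continuous g) {t : ℝ} (ht : 0 ≤ t)
    (h0 : ∀ s ∈ Set.Icc 0 t, 0 ≤ g s) :
    ∫⁻ s in Set.Icc 0 t, ENNReal.ofReal (g s) = ENNReal.ofReal (∫ s in (0 : ℝ)..t, g s) := by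
  rw [intervalIntegral.integral_of_le ht, ← integral_Icc_eq_integral_Ioc,
    ofReal_integral_eq_lintegral_ofReal]
  · exact (hg.continuousOn).integrableOn_compact isCompact_Icc
  · exact (ae_restrict_iff' measurableSet_Icc).2 (Filter.Eventually.of_forall h0)

theorem ofReal_integral_le_lintegral_Icc {g : ℝ → ℝ} (hg : Continuous g) {t : ℝ} (ht : 0 ≤ t) :
    ENNReal.ofReal (∫ s in (0 : ℝ)..t, g s) ≤ ∫⁻ s in Set.Icc 0 t, ENNReal.ofReal (g s) := by
  have h1 : ∀ s, ENNReal.ofReal (g s) = ENNReal.ofReal (max (g s) 0) := fun s => by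
    rcases le_total (g s) 0 with h | h
    · rw [max_eq_right h, ENNReal.ofReal_of_nonpos h, ENNReal.ofReal_zero]
    · rw [max_eq_left h]
  simp_rw [h1]
  have hc : Continuous fun s => max (g s) 0 := hg.max continuous_const
  rw [lintegral_Icc_ofReal_eq hc ht fun s _ => le_max_right _ _]
  refine ENNReal.ofReal_le_ofReal ?_
  exact intervalIntegral.integral_mono_on ht (hg.intervalIntegrable _ _)
    (hc.intervalIntegrable _ _) fun s _ => le_max_left _ _

section FiniteRange

variable {q : V → V → ℝ} {S : V → Finset V}

theorem tsum_rate_mul (hS : ∀ x z, z ∉ S x → q x z = 0) (F : V → ℝ≥0∞) (x : V) :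
    ∑' z, ENNReal.ofReal (q x z) * F z = ∑ z ∈ S x, ENNReal.ofReal (q x z) * F z :=
  tsum_eq_sum fun z hz => by simp [hS x z hz]

theorem exitRate_eq_sum (hS : ∀ x z, z ∉ S x → q x z = 0) (x : V) :
    exitRate q x = ∑ z ∈ S x, q x z := tsum_eq_sum fun z hz => hS x z hz

theorem tsum_rate_ofReal (hq : ∀ x z, 0 ≤ q x z) (hS : ∀ x z, z ∉ S x → q x z = 0) {F : V → ℝ}
    (hF : ∀ z, 0 ≤ F z) (x : V) :
    ∑' z, ENNReal.ofReal (q x z) * ENNReal.ofReal (F z) =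
      ENNReal.ofReal (∑ z ∈ S x, q x z * F z) := by
  rw [tsum_rate_mul hS, ENNReal.ofReal_sum_of_nonneg fun z _ => mul_nonneg (hq x z) (hF z)]
  exact Finset.sum_congr rfl fun z _ => (ENNReal.ofReal_mul (hq x z)).symm

/-- If the generator maps `W` to at most `C W`, then `a + W e ^ (C t)` is a supersolution of the
backward equation in its first-jump form. The last term is the contribution of the paths without
jump; it is kept since it makes the comparison argument contract. -/
theorem lintegral_barrier_le (hq : ∀ x z, 0 ≤ q x z) (hS : ∀ x z, z ∉ S x → q x z = 0)
    {W : V → ℝ} (hW : ∀ x, 0 ≤ W x) {C : ℝ} (hC : 0 ≤ C)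
    (hLW : ∀ x, ∑ z ∈ S x, q x z * W z ≤ (exitRate q x + C) * W x) {a : ℝ} (ha : 0 ≤ a)
    {t : ℝ} (ht : 0 ≤ t) (x : V) :
    ∫⁻ s in Set.Icc 0 t, ENNReal.ofReal (Real.exp (-(s * exitRate q x))) *
        ∑' z, ENNReal.ofReal (q x z) * ENNReal.ofReal (a + W z * Real.exp (C * (t - s))) ≤
      ENNReal.ofReal (a + W x * Real.exp (C * t) - Real.exp (-(t * exitRate q x)) * (a + W x)) := by
  have hQ : 0 ≤ exitRate q x := tsum_nonneg fun z => hq x z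
  rw [← integral_exp_mul_barrier, ← lintegral_Icc_ofReal_eq (by fun_prop) ht]
  · refine lintegral_mono fun s => ?_
    rw [tsum_rate_ofReal hq hS fun z => add_nonneg ha (mul_nonneg (hW z) (Real.exp_pos _).le),
      ← ENNReal.ofReal_mul (Real.exp_pos _).le]
    refine ENNReal.ofReal_le_ofReal (mul_le_mul_of_nonneg_left ?_ (Real.exp_pos _).le)
    have h1 : ∑ z ∈ S x, q x z * (a + W z * Real.exp (C * (t - s))) =
        exitRate q x * a + (∑ z ∈ S x, q x z * W z) * Real.exp (C * (t - s)) := by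
      rw [exitRate_eq_sum hS, Finset.sum_mul, Finset.sum_mul, ← Finset.sum_add_distrib]
      exact Finset.sum_congr rfl fun z _ => by ring
    have h2 := mul_le_mul_of_nonneg_right (hLW x) (Real.exp_pos (C * (t - s))).le
    rw [h1]
    linarith
  · intro s _
    have := Real.exp_pos (C * (t - s))
    have := hW x
    positivity

/-- A nonnegative function `W` whose image under the generator is at most `C W` has expectation
at most `e ^ (C t) W` at time `t`. -/
theorem expectBefore_le [Countable V] (hq : ∀ x z, 0 ≤ q x z) (hS : ∀ x z, z ∉ S x → q x z = 0)
    {W : V → ℝ} (hW : ∀ x, 0 ≤ W x) {C : ℝ} (hC : 0 ≤ C)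
    (hLW : ∀ x, ∑ z ∈ S x, q x z * W z ≤ (exitRate q x + C) * W x) (n : ℕ) :
    ∀ {t : ℝ}, 0 ≤ t → ∀ x, expectBefore q (fun x => ENNReal.ofReal (W x)) n t x ≤
      ENNReal.ofReal (W x * Real.exp (C * t)) := by
  induction n with
  | zero => intro t _ x; simp [expectBefore]
  | succ n ih =>
    intro t ht x
    rw [expectBefore_succ]
    have h1 := lintegral_barrier_le hq hS hW hC hLW le_rfl ht x
    simp only [zero_add] at h1
    calc _ ≤ ENNReal.ofReal (Real.exp (-(t * exitRate q x))) * ENNReal.ofReal (W x) +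
          ENNReal.ofReal (W x * Real.exp (C * t) - Real.exp (-(t * exitRate q x)) * W x) := by
          gcongr
          refine le_trans ?_ h1
          refine setLIntegral_mono' measurableSet_Icc fun s hs => ?_
          gcongr with z
          exact ih (sub_nonneg.2 hs.2) z
      _ = _ := by
          have hQ : 0 ≤ exitRate q x := tsum_nonneg fun z => hq x z
          rw [← ENNReal.ofReal_mul (Real.exp_pos _).le, ← ENNReal.ofReal_add]
          · congr 1; ring
          · exact mul_nonneg (Real.exp_pos _).le (hW x)
          · have : Real.exp (-(t * exitRate q x)) ≤ Real.exp (C * t) :=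
              Real.exp_le_exp.2 (by have := mul_nonneg ht hQ; have := mul_nonneg hC ht; linarith)
            nlinarith [hW x]

/-- Comparison from below. Let `H t x = A x + e ^ (μ t) φ x` be a subsolution of the backward
equation. Its growth is controlled by `U`, whose square is a Lyapunov function with finite sublevel
sets; this rules out that mass escapes to infinity in finite time. -/
theorem subsolution_le_tsum [Countable V] (hq : ∀ x z, 0 ≤ q x z)
    (hS : ∀ x z, z ∉ S x → q x z = 0) {U : V → ℝ} (hU : ∀ x, 1 ≤ U x)
    (hfin : ∀ c, {x | U x ≤ c}.Finite) {C : ℝ} (hC : 0 ≤ C)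
    (hLU : ∀ x, ∑ z ∈ S x, q x z * U z ^ 2 ≤ (exitRate q x + C) * U x ^ 2)
    {A φ : V → ℝ} {μ T a : ℝ} (ha : 0 ≤ a)
    (hH : ∀ t ∈ Set.Icc 0 T, ∀ x, A x + φ x * Real.exp (μ * t) ≤ a * U x)
    (hsub : ∀ t ∈ Set.Icc 0 T, ∀ x,
      exitRate q x * (A x + φ x * Real.exp (μ * t)) + φ x * μ * Real.exp (μ * t) ≤
        ∑ z ∈ S x, q x z * (A z + φ z * Real.exp (μ * t)))
    {h : V → ℝ≥0∞} (hh : ∀ x, ENNReal.ofReal (A x + φ x) ≤ h x) {t : ℝ} (ht : t ∈ Set.Icc 0 T)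
    (x : V) :
    ENNReal.ofReal (A x + φ x * Real.exp (μ * t)) ≤ ∑' y, transitionProb q t x y * h y := by
  set H : ℝ → V → ℝ := fun t x => A x + φ x * Real.exp (μ * t) with hHdef
  have hQ : ∀ x, 0 ≤ exitRate q x := fun x => tsum_nonneg fun z => hq x z
  -- the first-jump form of the subsolution property
  have mild : ∀ t ∈ Set.Icc 0 T, ∀ x, ENNReal.ofReal (H t x) ≤
      ENNReal.ofReal (Real.exp (-(t * exitRate q x))) * h x +
      ∫⁻ s in Set.Icc 0 t, ENNReal.ofReal (Real.exp (-(s * exitRate q x))) *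
        ∑' z, ENNReal.ofReal (q x z) * ENNReal.ofReal (H (t - s) z) := by
    intro t ht x
    have e1 : H t x = Real.exp (-(t * exitRate q x)) * (A x + φ x) +
        ∫ s in (0 : ℝ)..t, Real.exp (-(s * exitRate q x)) *
        (exitRate q x * (A x + φ x * Real.exp (μ * (t - s))) +
          φ x * μ * Real.exp (μ * (t - s))) := by
      rw [integral_exp_mul_barrier]; ring
    rw [e1]
    refine ENNReal.ofReal_add_le.trans (add_le_add ?_ ?_)
    · rw [ENNReal.ofReal_mul (Real.exp_pos _).le]
      gcongr
      exact hh x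
    · refine (ofReal_integral_le_lintegral_Icc (by fun_prop) ht.1).trans ?_
      refine setLIntegral_mono' measurableSet_Icc fun s hs => ?_
      rw [ENNReal.ofReal_mul (Real.exp_pos _).le]
      gcongr
      refine (ENNReal.ofReal_le_ofReal (hsub (t - s) ⟨sub_nonneg.2 hs.2, ?_⟩ x)).trans ?_
      · linarith [ht.2, hs.1]
      · rw [tsum_rate_mul hS]
        refine (Finset.le_sum_of_subadditive ENNReal.ofReal ENNReal.ofReal_zero.le
          (fun _ _ => ENNReal.ofReal_add_le) _ _).trans (Finset.sum_le_sum fun z _ => ?_)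
        rw [ENNReal.ofReal_mul (hq x z)]
  -- On `{U ≤ a / η}` the exit rates are bounded, so each jump contracts the error `A' * ρ ^ n`;
  -- elsewhere `H` is below the Lyapunov barrier.
  have key : ∀ η : ℝ, 0 < η → ∃ A' ρ : ℝ, 0 ≤ A' ∧ 0 ≤ ρ ∧ ρ < 1 ∧ ∀ n : ℕ, ∀ t ∈ Set.Icc 0 T,
      ∀ x, ENNReal.ofReal (H t x) ≤ expectBefore q h n t x +
        ENNReal.ofReal (A' * ρ ^ n + η * U x ^ 2 * Real.exp (C * t)) := by
    intro η hη
    obtain ⟨M, hM⟩ : ∃ M, ∀ x, U x ≤ a / η → exitRate q x ≤ M := by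
      obtain ⟨M, hM⟩ := ((hfin (a / η)).image (exitRate q)).bddAbove
      exact ⟨M, fun x hx => hM ⟨x, hx, rfl⟩⟩
    have hexp1 : ∀ t ∈ Set.Icc 0 T, 1 ≤ Real.exp (C * t) := fun t ht =>
      Real.one_le_exp (mul_nonneg hC ht.1)
    refine ⟨a ^ 2 / (4 * η), 1 - Real.exp (-(T * |M|)), by positivity, ?_, ?_, ?_⟩
    · rcases le_or_gt 0 T with hT | hT
      · have : Real.exp (-(T * |M|)) ≤ 1 := Real.exp_le_one_iff.2 (by
          have := mul_nonneg hT (abs_nonneg M); linarith)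
        linarith
      · exact absurd (ht.1.trans ht.2) (not_le.2 hT)
    · linarith [Real.exp_pos (-(T * |M|))]
    set ρ := 1 - Real.exp (-(T * |M|)) with hρ
    intro n
    induction n with
    | zero =>
      intro t ht x
      rw [pow_zero, mul_one]
      refine le_trans (ENNReal.ofReal_le_ofReal ?_) le_add_self
      refine (hH t ht x).trans ?_
      have h1 := hexp1 t ht
      have h2 : a * U x ≤ a ^ 2 / (4 * η) + η * U x ^ 2 := by
        have : a ^ 2 / (4 * η) + η * U x ^ 2 - a * U x = (a - 2 * η * U x) ^ 2 / (4 * η) := by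
          field_simp; ring
        have h3 : 0 ≤ (a - 2 * η * U x) ^ 2 / (4 * η) := by positivity
        linarith
      have h3 : 0 ≤ η * U x ^ 2 := by positivity
      nlinarith
    | succ n ih =>
      intro t ht x
      have hT : 0 ≤ T := ht.1.trans ht.2
      have hρ0 : 0 ≤ ρ := by
        have : Real.exp (-(T * |M|)) ≤ 1 := Real.exp_le_one_iff.2 (by
          have := mul_nonneg hT (abs_nonneg M); linarith)
        linarith
      by_cases hx : U x ≤ a / η
      · set A' := a ^ 2 / (4 * η) * ρ ^ n with hA'
        have hA0 : 0 ≤ A' := by positivity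
        have hb := lintegral_barrier_le hq hS (W := fun x => η * U x ^ 2)
          (fun x => by positivity) hC (fun x => by
            have := mul_le_mul_of_nonneg_left (hLU x) hη.le
            rw [Finset.mul_sum] at this
            calc _ = ∑ z ∈ S x, η * (q x z * U z ^ 2) :=
                  Finset.sum_congr rfl fun z _ => by ring
              _ ≤ _ := this
              _ = _ := by ring) hA0 ht.1 x
        calc ENNReal.ofReal (H t x) ≤ _ := mild t ht x
          _ ≤ ENNReal.ofReal (Real.exp (-(t * exitRate q x))) * h x +
              ∫⁻ s in Set.Icc 0 t, (ENNReal.ofReal (Real.exp (-(s * exitRate q x))) *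
                ∑' z, ENNReal.ofReal (q x z) * expectBefore q h n (t - s) z +
                ENNReal.ofReal (Real.exp (-(s * exitRate q x))) *
                ∑' z, ENNReal.ofReal (q x z) *
                  ENNReal.ofReal (A' + η * U z ^ 2 * Real.exp (C * (t - s)))) := by
              refine add_le_add le_rfl ?_
              refine setLIntegral_mono' measurableSet_Icc fun s hs => ?_
              rw [← mul_add, ← ENNReal.tsum_add]
              gcongr with z
              rw [← mul_add]
              gcongr
              exact ih (t - s) ⟨sub_nonneg.2 hs.2, by linarith [ht.2, hs.1]⟩ z
          _ ≤ expectBefore q h (n + 1) t x + ENNReal.ofReal (A' + η * U x ^ 2 * Real.exp (C * t) -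
                Real.exp (-(t * exitRate q x)) * (A' + η * U x ^ 2)) := by
              rw [lintegral_add_left, ← add_assoc, ← expectBefore_succ]
              · gcongr
              · refine Measurable.mul (by fun_prop) (Measurable.tsum fun z => ?_)
                exact Measurable.const_mul
                  ((measurable_expectBefore q h n z).comp (by fun_prop)) _
          _ ≤ _ := by
              gcongr
              have h1 : Real.exp (-(T * |M|)) ≤ Real.exp (-(t * exitRate q x)) := by
                refine Real.exp_le_exp.2 (neg_le_neg ?_)
                exact mul_le_mul ht.2 ((hM x hx).trans (le_abs_self M)) (hQ x) hT
              have h2 : 0 ≤ η * U x ^ 2 := by positivity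
              rw [pow_succ ρ, ← mul_assoc, ← hA']
              have h3 := Real.exp_pos (-(t * exitRate q x))
              have h4 := mul_le_mul_of_nonneg_right h1 hA0
              have h5 := mul_nonneg h3.le h2
              rw [hρ]
              nlinarith
      · rw [not_le, div_lt_iff₀ hη] at hx
        refine le_trans (ENNReal.ofReal_le_ofReal ?_) le_add_self
        refine (hH t ht x).trans ?_
        have h1 := hexp1 t ht
        have h2 : 0 < U x := lt_of_lt_of_le one_pos (hU x)
        have h3 : 0 ≤ a ^ 2 / (4 * η) * ρ ^ (n + 1) := by positivity
        have h4 : a * U x ≤ η * U x ^ 2 := by nlinarith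
        have h5 : 0 ≤ η * U x ^ 2 := by positivity
        nlinarith
  have hle : ∀ n, expectBefore q h n t x ≤ ∑' y, transitionProb q t x y * h y := by
    intro n
    have : ∑' y, transitionProb q t x y * h y = ∑' k, ∑' y, jumpProb q k t x y * h y := by
      simp_rw [transitionProb, ← ENNReal.tsum_mul_right]
      rw [ENNReal.tsum_comm]
    rw [this]
    exact ENNReal.sum_le_tsum _
  set X := ∑' y, transitionProb q t x y * h y
  have hη : ∀ η : ℝ, 0 < η → ENNReal.ofReal (H t x) ≤
      X + ENNReal.ofReal (η * U x ^ 2 * Real.exp (C * t)) := by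
    intro η hη
    obtain ⟨A', ρ, -, hρ0, hρ1, hk⟩ := key η hη
    have hlim : Filter.Tendsto (fun n : ℕ => X +
        ENNReal.ofReal (A' * ρ ^ n + η * U x ^ 2 * Real.exp (C * t))) Filter.atTop
        (nhds (X + ENNReal.ofReal (A' * 0 + η * U x ^ 2 * Real.exp (C * t)))) :=
      tendsto_const_nhds.add (ENNReal.tendsto_ofReal
        (((tendsto_pow_atTop_nhds_zero_of_lt_one hρ0 hρ1).const_mul A').add_const _))
    rw [mul_zero, zero_add] at hlim
    exact ge_of_tendsto' hlim fun n => (hk n t ht x).trans (add_le_add (hle n) le_rfl)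
  have hlim : Filter.Tendsto (fun η : ℝ => X + ENNReal.ofReal (η * U x ^ 2 * Real.exp (C * t)))
      (nhdsWithin 0 (Set.Ioi 0)) (nhds (X + ENNReal.ofReal (0 * U x ^ 2 * Real.exp (C * t)))) :=
    tendsto_const_nhds.add (ENNReal.tendsto_ofReal
      (Continuous.tendsto (by fun_prop) (0 : ℝ) |>.mono_left nhdsWithin_le_nhds))
  rw [zero_mul, zero_mul, ENNReal.ofReal_zero, add_zero] at hlim
  exact ge_of_tendsto hlim (Filter.eventually_of_mem self_mem_nhdsWithin fun η h => hη η h)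

/-- The expectation of a nonnegative function under a Lyapunov condition. -/
theorem tsum_transitionProb_mul_le [Countable V] (hq : ∀ x z, 0 ≤ q x z)
    (hS : ∀ x z, z ∉ S x → q x z = 0)
    {W : V → ℝ} (hW : ∀ x, 0 ≤ W x) {C : ℝ} (hC : 0 ≤ C)
    (hLW : ∀ x, ∑ z ∈ S x, q x z * W z ≤ (exitRate q x + C) * W x) {t : ℝ} (ht : 0 ≤ t) (x : V) :
    ∑' y, transitionProb q t x y * ENNReal.ofReal (W y) ≤
      ENNReal.ofReal (W x * Real.exp (C * t)) := by
  have : ∑' y, transitionProb q t x y * ENNReal.ofReal (W y) =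
      ∑' k, ∑' y, jumpProb q k t x y * ENNReal.ofReal (W y) := by
    simp_rw [transitionProb, ← ENNReal.tsum_mul_right]
    rw [ENNReal.tsum_comm]
  rw [this]
  exact ENNReal.tsum_le_of_sum_range_le fun n => expectBefore_le hq hS hW hC hLW n ht x

/-- A chain with a Lyapunov function whose sublevel sets are finite does not explode. -/
theorem tsum_transitionProb_eq_one [Countable V] (hq : ∀ x z, 0 ≤ q x z)
    (hS : ∀ x z, z ∉ S x → q x z = 0) {U : V → ℝ} (hU : ∀ x, 1 ≤ U x)
    (hfin : ∀ c, {x | U x ≤ c}.Finite) {C : ℝ} (hC : 0 ≤ C)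
    (hLU : ∀ x, ∑ z ∈ S x, q x z * U z ^ 2 ≤ (exitRate q x + C) * U x ^ 2)
    {t : ℝ} (ht : 0 ≤ t) (x : V) : ∑' y, transitionProb q t x y = 1 := by
  refine le_antisymm ?_ ?_
  · have h := tsum_transitionProb_mul_le hq hS (W := fun _ => 1) (fun _ => zero_le_one) le_rfl
      (fun x => by simp [exitRate_eq_sum hS]) ht x
    simpa using h
  · have h := subsolution_le_tsum hq hS hU hfin hC hLU (A := fun _ => 1) (φ := fun _ => 0) (μ := 0)
      (T := t) (a := 1) zero_le_one (fun _ _ x => by simpa using hU x)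
      (fun _ _ x => by simp [exitRate_eq_sum hS]) (h := fun _ => 1) (fun _ => by simp)
      ⟨ht, le_rfl⟩ x
    simpa using h

end FiniteRange

end MarkovChain

/-! ### The parallelogram law on the triangular lattice -/

section Lattice

variable {Z : Type*} [AddCommGroup Z] {D : Z → ℝ}

/-- The parallelogram inequality makes `D` convex along each ray. -/
theorem monotone_nsmul_of_parallelogram_le (hpar : ∀ x y, 2 * D x + 2 * D y ≤ D (x + y) + D (x - y))
    (h0 : D 0 = 0) {x : Z} (hx : 0 ≤ D x) : Monotone fun k : ℕ => D (k • x) := by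
  refine monotone_nat_of_le_succ fun k => ?_
  induction k with
  | zero => simpa [h0] using hx
  | succ k ih =>
    have h := hpar ((k + 1) • x) x
    rw [← succ_nsmul, succ_nsmul x k, add_sub_cancel_right, ← succ_nsmul] at h
    linarith

/-- Climbing: Euclid's algorithm carries the positivity of a function with the parallelogram
inequality from a pair of lattice vectors to the whole open sector which they span. -/
theorem pos_of_mem_sector (hpar : ∀ x y, 2 * D x + 2 * D y ≤ D (x + y) + D (x - y))
    (h0 : D 0 = 0) (hneg : ∀ x, D (-x) = D x) (N : ℕ) :
    ∀ (i j : ℕ) (x y : Z), i + j ≤ N → 0 < i → 0 < j → 0 ≤ D x → 0 ≤ D y →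
      D (x - y) < D (x + y) → 0 < D (i • x + j • y) := by
  induction N with
  | zero => intro i j x y h hi; omega
  | succ N ih =>
    intro i j x y h hi hj hx hy hxy
    have h1 := hpar x y
    have hs : 0 < D (x + y) := by linarith
    rcases lt_trichotomy i j with hij | rfl | hij
    · have e : i • x + j • y = i • (x + y) + (j - i) • y := by
        obtain ⟨k, rfl⟩ := Nat.exists_eq_add_of_lt hij
        rw [show i + k + 1 - i = k + 1 by omega]
        simp only [add_smul, smul_add]; abel
      rw [e]
      refine ih _ _ _ _ (by omega) hi (by omega) hs.le hy ?_
      have h2 := hpar (x + y) y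
      rw [add_sub_cancel_right] at h2 ⊢
      linarith
    · rw [← smul_add]
      have := monotone_nsmul_of_parallelogram_le hpar h0 hs.le (show 1 ≤ i from hi)
      simp only [one_smul] at this
      linarith
    · have e : i • x + j • y = (i - j) • x + j • (x + y) := by
        obtain ⟨k, rfl⟩ := Nat.exists_eq_add_of_lt hij
        rw [show j + k + 1 - j = k + 1 by omega]
        simp only [add_smul, smul_add]; abel
      rw [e]
      refine ih _ _ _ _ (by omega) (by omega) hj hx hs.le ?_
      have h2 := hpar x (x + y)
      rw [show x - (x + y) = -y by abel, hneg] at h2 ⊢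
      linarith

end Lattice

/-- The position of the `i`-th corner of a face `w`, relative to the corner `v(w)`. The corner `0`
is opposite to the NE-SW edge, the corner `1` to the NW-SE edge, and the corner `2` to the
vertical edge. -/
def corner : Fin 3 → ℤ × ℤ := ![(0, 0), (1, 0), (0, 1)]

/-- The kind of the edge dual to the side opposite to the `i`-th corner. -/
def opp : Fin 3 → EdgeKind := ![.nesw, .nwse, .vertical]

/-- A function on the triangular lattice which vanishes at `0` and at its six neighbours, and which
exceeds the parallelogram law, is positive everywhere else. -/
theorem pos_or_mem_of_parallelogram {D G : ℤ × ℤ → ℝ} {c : ℝ} (hc : 0 < c)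
    (hpar : ∀ x y, D (x + y) + D (x - y) = 2 * D x + 2 * D y + c * (G x * G y))
    (hG : ∀ x, 0 ≤ G x) (h0 : D 0 = 0) (hneg : ∀ x, D (-x) = D x)
    (hD1 : D (1, 0) = 0) (hD2 : D (0, 1) = 0) (hD3 : D (-1, 1) = 0)
    (hG1 : 0 < G (1, 0)) (hG2 : 0 < G (0, 1)) (hG3 : 0 < G (-1, 1)) (z : ℤ × ℤ) :
    0 < D z ∨ (D z = 0 ∧ (z = 0 ∨ ∃ i j, i ≠ j ∧ z = corner i - corner j)) := by
  have hpar' : ∀ x y, 2 * D x + 2 * D y ≤ D (x + y) + D (x - y) := fun x y => by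
    have := mul_nonneg hc.le (mul_nonneg (hG x) (hG y))
    linarith [hpar x y]
  -- a sector between two edge vectors whose difference is an edge vector
  have sector : ∀ x y, D x = 0 → D y = 0 → D (x - y) = 0 → 0 < G x → 0 < G y →
      ∀ i j : ℕ, 0 < i → 0 < j → 0 < D (i • x + j • y) := by
    intro x y hx hy hxy gx gy i j hi hj
    refine pos_of_mem_sector hpar' h0 hneg _ i j x y le_rfl hi hj hx.ge hy.ge ?_
    have := mul_pos hc (mul_pos gx gy)
    linarith [hpar x y]
  have ray : ∀ x, D x = 0 → 0 < G x → ∀ k : ℕ, 2 ≤ k → 0 < D (k • x) := by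
    intro x hx gx k hk
    have h1 := monotone_nsmul_of_parallelogram_le hpar' h0 hx.ge hk
    have h2 := hpar x x
    rw [sub_self, h0, hx, ← two_nsmul] at h2
    have := mul_pos hc (mul_pos gx gx)
    simp only at h1
    linarith
  have upper : ∀ z : ℤ × ℤ, 0 < z.2 ∨ (z.2 = 0 ∧ 0 < z.1) →
      0 < D z ∨ (D z = 0 ∧ ∃ i j, i ≠ j ∧ z = corner i - corner j) := by
    rintro ⟨m, n⟩ h
    simp only at h
    have hz : ∀ x : ℤ × ℤ, D x = 0 → 0 < G x → (∃ i j, i ≠ j ∧ x = corner i - corner j) →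
        ∀ k : ℤ, 0 < k → (m, n) = k • x → 0 < D (m, n) ∨
        (D (m, n) = 0 ∧ ∃ i j, i ≠ j ∧ (m, n) = corner i - corner j) := by
      intro x hx gx he k hk e
      rcases eq_or_ne k 1 with rfl | hk1
      · rw [e, one_smul]; exact Or.inr ⟨hx, he⟩
      · left
        lift k to ℕ using hk.le
        rw [e, natCast_zsmul]
        exact ray x hx gx k (by omega)
    have hs : ∀ x y : ℤ × ℤ, D x = 0 → D y = 0 → D (x - y) = 0 → 0 < G x → 0 < G y →
        ∀ i j : ℤ, 0 < i → 0 < j → (m, n) = i • x + j • y → 0 < D (m, n) ∨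
        (D (m, n) = 0 ∧ ∃ i j, i ≠ j ∧ (m, n) = corner i - corner j) := by
      intro x y hx hy hxy gx gy i j hi hj e
      left
      lift i to ℕ using hi.le
      lift j to ℕ using hj.le
      rw [e, natCast_zsmul, natCast_zsmul]
      exact sector x y hx hy hxy gx gy i j (by omega) (by omega)
    have hG1' : D (-1, 0) = 0 ∧ 0 < G (-1, 0) := by
      have e : ((-1 : ℤ), (0 : ℤ)) = -(1, 0) := by simp
      refine ⟨by rw [e, hneg, hD1], ?_⟩
      have h1 := hpar (1, 0) (1, 0)
      have h2 := hpar (1, 0) (-1, 0)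
      have h3 : D (-1, 0) = 0 := by rw [e, hneg, hD1]
      rw [e, ← sub_eq_add_neg, sub_neg_eq_add, ← e, h3, hD1] at h2
      rw [hD1] at h1
      have h4 : c * (G (1, 0) * G (-1, 0)) = c * (G (1, 0) * G (1, 0)) := by linarith
      have h5 := mul_left_cancel₀ hG1.ne' (mul_left_cancel₀ hc.ne' h4)
      rw [h5]; exact hG1
    rcases lt_trichotomy n 0 with hn | hn | hn
    · omega
    · exact hz (1, 0) hD1 hG1 ⟨1, 0, by decide, by simp [corner]⟩ m (by omega) (by simp [hn])
    · rcases lt_trichotomy m 0 with hm | hm | hm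
      · rcases lt_trichotomy (m + n) 0 with h1 | h1 | h1
        · exact hs (-1, 1) (-1, 0) hD3 hG1'.1 (by simpa using hD2) hG3 hG1'.2 n (-m - n) (by omega)
            (by omega) (by simp)
        · exact hz (-1, 1) hD3 hG3 ⟨2, 1, by decide, by simp [corner]⟩ n hn (by simp; omega)
        · exact hs (0, 1) (-1, 1) hD2 hD3 (by simpa using hD1) hG2 hG3 (m + n) (-m) (by omega)
            (by omega) (by simp)
      · exact hz (0, 1) hD2 hG2 ⟨2, 0, by decide, by simp [corner]⟩ n hn (by simp [hm])
      · refine hs (1, 0) (0, 1) hD1 hD2 ?_ hG1 hG2 m n hm hn (by simp)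
        rw [← hneg]; simpa using hD3
  rcases lt_trichotomy z.2 0 with h | h | h
  · rcases upper (-z) (Or.inl (by simpa using h)) with h1 | ⟨h1, i, j, hij, e⟩
    · left; rwa [hneg] at h1
    · right; exact ⟨by rwa [hneg] at h1, Or.inr ⟨j, i, hij.symm, by rw [← neg_neg z, e, neg_sub]⟩⟩
  · rcases lt_trichotomy z.1 0 with h' | h' | h'
    · rcases upper (-z) (Or.inr (by simp; omega)) with h1 | ⟨h1, i, j, hij, e⟩
      · left; rwa [hneg] at h1
      · right; exact ⟨by rwa [hneg] at h1, Or.inr ⟨j, i, hij.symm, by rw [← neg_neg z, e, neg_sub]⟩⟩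
    · have : z = 0 := Prod.ext h' h
      rw [this]; exact Or.inr ⟨h0, Or.inl rfl⟩
    · rcases upper z (Or.inr ⟨h, h'⟩) with h1 | ⟨h1, h2⟩
      · exact Or.inl h1
      · exact Or.inr ⟨h1, Or.inr h2⟩
  · rcases upper z (Or.inl h) with h1 | ⟨h1, h2⟩
    · exact Or.inl h1
    · exact Or.inr ⟨h1, Or.inr h2⟩

/-! ### The primitive as a perturbation of a linear map -/

theorem norm_dir (Δ : UnitTriangle) (e : EdgeKind) : ‖dir Δ e‖ = 1 := by
  rw [dir, norm_div, Complex.norm_real, len, norm_norm]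
  exact div_self (norm_ne_zero_iff.2 (side_ne_zero Δ e))

theorem len_pos (Δ : UnitTriangle) (e : EdgeKind) : 0 < len Δ e :=
  norm_pos_iff.2 (side_ne_zero Δ e)

theorem f_add (Δ : UnitTriangle) (z z' : ℤ × ℤ) : f Δ (z + z') = f Δ z * f Δ z' := by
  have ha := dir_ne_zero Δ .vertical
  have hb := dir_ne_zero Δ .nesw
  have hc := dir_ne_zero Δ .nwse
  simp only [f, Prod.fst_add, Prod.snd_add]
  rw [zpow_add₀ (div_ne_zero hb ha), zpow_add₀ (div_ne_zero hb hc)]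
  ring

theorem f_zero (Δ : UnitTriangle) : f Δ 0 = 1 := by simp [f]

theorem norm_f (Δ : UnitTriangle) (z : ℤ × ℤ) : ‖f Δ z‖ = 1 := by
  simp [f, norm_dir]

theorem f_ne_zero (Δ : UnitTriangle) (z : ℤ × ℤ) : f Δ z ≠ 0 :=
  norm_ne_zero_iff.1 (by rw [norm_f]; exact one_ne_zero)

theorem f_neg (Δ : UnitTriangle) (z : ℤ × ℤ) : f Δ (-z) = (f Δ z)⁻¹ := by
  refine eq_inv_of_mul_eq_one_left ?_
  rw [← f_add, neg_add_cancel, f_zero]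

/-- The face `w` of the T-graph is the triangle `Δ` rotated by `λ f w` and scaled by this signed
contraction ratio, see `psi_corner_succ`. -/
noncomputable def ratio (Δ : UnitTriangle) (lam : Circle) (w : ℤ × ℤ) : ℝ := ((lam : ℂ) * f Δ w).re

theorem flow_eq (Δ : UnitTriangle) (lam : Circle) (w : ℤ × ℤ) (e : EdgeKind) :
    flow Δ lam w e = side Δ e * ((lam : ℂ) * f Δ w) * ratio Δ lam w := by
  have ha := dir_ne_zero Δ .vertical
  have hb := dir_ne_zero Δ .nesw
  have hc := dir_ne_zero Δ .nwse
  have hr : (conj (lam : ℂ) * conj (f Δ w)).re = ratio Δ lam w := by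
    rw [← map_mul, Complex.conj_re, ratio]
  have hg : g Δ (blackEnd e w) = dir Δ e * f Δ w := by
    cases e <;> simp only [g, blackEnd, f]
    · rw [zpow_add₀ (div_ne_zero hb ha), zpow_one]; field_simp
    · rw [zpow_add₀ (div_ne_zero hb ha), zpow_sub₀ (div_ne_zero hb hc), zpow_one, zpow_one]
      field_simp
  rw [flow, hr, hg, ← len_mul_dir]
  ring

theorem two_mul_ratio_mul (Δ : UnitTriangle) (lam : Circle) (w : ℤ × ℤ) :
    2 * (((lam : ℂ) * f Δ w) * ratio Δ lam w) = ((lam : ℂ) * f Δ w) ^ 2 + 1 := by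
  have h1 : ‖(lam : ℂ) * f Δ w‖ = 1 := by
    rw [norm_mul, norm_f, Circle.norm_coe, one_mul]
  have h2 := Complex.mul_conj' ((lam : ℂ) * f Δ w)
  rw [h1, Complex.ofReal_one, one_pow] at h2
  rw [ratio, Complex.re_eq_add_conj]
  linear_combination h2

/-- The sides of a face of the T-graph. -/
theorem psi_corner_succ (Δ : UnitTriangle) (lam : Circle) (w : ℤ × ℤ) (i : Fin 3) :
    psi Δ lam (w + corner (i + 1)) - psi Δ lam (w + corner i) =
      side Δ (opp (i + 2)) * ((lam : ℂ) * f Δ w) * ratio Δ lam w := by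
  obtain ⟨m, n⟩ := w
  rw [← flow_eq]
  fin_cases i
  · simpa [corner, opp] using psi_right Δ lam m n
  · simpa [corner, opp] using psi_diag Δ lam m n
  · have := psi_up Δ lam m n
    simp [corner, opp]
    linear_combination -this

theorem cross_one (Δ : UnitTriangle) :
    (conj (side Δ .vertical) * side Δ .nesw).im = 2 := Δ.2.2

theorem cross_side (Δ : UnitTriangle) (i : Fin 3) :
    (conj (side Δ (opp i)) * side Δ (opp (i + 1))).im = 2 := by
  have h1 := cross_one Δ
  have h2 := side_sum Δ
  have h3 : side Δ .nwse = -side Δ .vertical - side Δ .nesw := by linear_combination h2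
  simp only [Complex.mul_im, Complex.conj_re, Complex.conj_im] at h1
  fin_cases i <;> simp [opp, h3] <;> linarith

theorem f_corner (Δ : UnitTriangle) (i : Fin 3) :
    f Δ (corner i) = dir Δ .nesw / dir Δ (opp i) := by
  fin_cases i <;> simp [f, corner, opp, dir_ne_zero]

/-- The linear part of `2 ψ`. -/
noncomputable def lattice (Δ : UnitTriangle) (z : ℤ × ℤ) : ℂ :=
  z.1 * side Δ .vertical - z.2 * side Δ .nwse

theorem lattice_sub (Δ : UnitTriangle) (z z' : ℤ × ℤ) :
    lattice Δ (z - z') = lattice Δ z - lattice Δ z' := by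
  simp [lattice]; ring

theorem sq_div_sub_one_ne_zero (Δ : UnitTriangle) :
    (dir Δ .nesw / dir Δ .nwse) ^ 2 - 1 ≠ 0 := by
  intro h
  have hc := dir_ne_zero Δ .nwse
  have h1 : (dir Δ .nesw - dir Δ .nwse) * (dir Δ .nesw + dir Δ .nwse) = 0 := by
    field_simp at h
    linear_combination h
  have h2 : (conj (side Δ .nesw) * side Δ .nwse).im = 2 := by simpa [opp] using cross_side Δ 0
  have key : ∀ s : ℝ, dir Δ .nwse = s * dir Δ .nesw → False := by
    intro s hs
    rw [← len_mul_dir Δ .nesw, ← len_mul_dir Δ .nwse, hs] at h2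
    simp only [Complex.mul_im, Complex.conj_re, Complex.conj_im, Complex.ofReal_re,
      Complex.ofReal_im, Complex.mul_re] at h2
    ring_nf at h2
    norm_num at h2
  rcases mul_eq_zero.1 h1 with h | h
  · exact key 1 (by push_cast; linear_combination -h)
  · exact key (-1) (by push_cast; linear_combination h)

/-- The coefficient of the oscillating part of `2 ψ`, see `two_mul_psi`; its modulus is the radius
of the circle which carries this part. -/
noncomputable def osc (Δ : UnitTriangle) : ℂ :=
  side Δ .vertical / ((dir Δ .nesw / dir Δ .nwse) ^ 2 - 1)

theorem osc_mul_right (Δ : UnitTriangle) :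
    osc Δ * ((dir Δ .nesw / dir Δ .nwse) ^ 2 - 1) = side Δ .vertical :=
  div_mul_cancel₀ _ (sq_div_sub_one_ne_zero Δ)

theorem osc_mul_up (Δ : UnitTriangle) :
    osc Δ * ((dir Δ .nesw / dir Δ .vertical) ^ 2 - 1) = -side Δ .nwse := by
  have h := side_sum Δ
  have h' := congrArg conj (side_sum Δ)
  rw [← len_mul_dir, ← len_mul_dir, ← len_mul_dir] at h h'
  simp only [map_add, map_mul, conj_dir, Complex.conj_ofReal, map_zero] at h'
  have ha := dir_ne_zero Δ .vertical
  have hb := dir_ne_zero Δ .nesw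
  have hc := dir_ne_zero Δ .nwse
  rw [osc, div_mul_eq_mul_div, div_eq_iff (sq_div_sub_one_ne_zero Δ), ← len_mul_dir, ← len_mul_dir]
  field_simp at h' ⊢
  linear_combination h' * dir Δ .nesw - h * dir Δ .nwse * dir Δ .vertical

/-- A function on the square lattice whose increments vanish is constant. -/
theorem eq_of_increments_eq_zero {F : ℤ × ℤ → ℂ} (h1 : ∀ m n, F (m + 1, n) = F (m, n))
    (h2 : ∀ m n, F (m, n + 1) = F (m, n)) (z : ℤ × ℤ) : F z = F 0 := by
  have e1 : ∀ m n, F (m, n) = F (m, 0) := by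
    intro m n
    induction n using Int.induction_on with
    | zero => rfl
    | succ k ih => rw [h2, ih]
    | pred k ih => rw [← ih, ← h2, sub_add_cancel]
  have e2 : ∀ m, F (m, 0) = F (0, 0) := by
    intro m
    induction m using Int.induction_on with
    | zero => rfl
    | succ k ih => rw [h1, ih]
    | pred k ih => rw [← ih, ← h1, sub_add_cancel]
  exact (e1 z.1 z.2).trans (e2 z.1)

/-- `2 ψ` is the sum of a linear map and of a map with values in a circle. -/
theorem two_mul_psi (Δ : UnitTriangle) (lam : Circle) (z : ℤ × ℤ) :
    2 * psi Δ lam z = lattice Δ z + (lam : ℂ) ^ 2 * osc Δ * (f Δ z ^ 2 - 1) := by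
  have h := eq_of_increments_eq_zero (F := fun z =>
    2 * psi Δ lam z - lattice Δ z - (lam : ℂ) ^ 2 * osc Δ * (f Δ z ^ 2 - 1)) ?_ ?_ z
  · have h0 := psi_zero Δ lam
    have h0' : psi Δ lam 0 = 0 := h0
    simp [h0', f_zero, lattice] at h
    simp only [lattice]
    linear_combination h
  · intro m n
    have e1 := psi_right Δ lam m n
    have e2 := two_mul_ratio_mul Δ lam (m, n)
    have e3 := osc_mul_right Δ
    have e4 : f Δ (m + 1, n) = f Δ (m, n) * (dir Δ .nesw / dir Δ .nwse) := by
      have := f_add Δ (m, n) (1, 0)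
      simpa [f] using this
    rw [flow_eq] at e1
    simp only [lattice, e4]
    push_cast
    linear_combination 2 * e1 + side Δ .vertical * e2 - (lam : ℂ) ^ 2 * f Δ (m, n) ^ 2 * e3
  · intro m n
    have e1 := psi_up Δ lam m n
    have e2 := two_mul_ratio_mul Δ lam (m, n)
    have e3 := osc_mul_up Δ
    have e4 : f Δ (m, n + 1) = f Δ (m, n) * (dir Δ .nesw / dir Δ .vertical) := by
      have := f_add Δ (m, n) (0, 1)
      simpa [f] using this
    rw [flow_eq] at e1
    simp only [lattice, e4]
    push_cast
    linear_combination 2 * e1 - side Δ .nwse * e2 - (lam : ℂ) ^ 2 * f Δ (m, n) ^ 2 * e3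

/-- The squared length of the increment of the oscillating part of `2 ψ` from `z'` to `z + z'`,
which does not depend on `z'`. -/
noncomputable def oscSq (Δ : UnitTriangle) (z : ℤ × ℤ) : ℝ := ‖osc Δ‖ ^ 2 * ‖f Δ z ^ 2 - 1‖ ^ 2

/-- The excess of the squared increment of the linear part of `2 ψ` over that of its oscillating
part. By `defect_sub` it is nonnegative if and only if `ψ`, as a function of its linear part, is
firmly nonexpansive. -/
noncomputable def defect (Δ : UnitTriangle) (z : ℤ × ℤ) : ℝ := ‖lattice Δ z‖ ^ 2 - oscSq Δ z

theorem osc_ne_zero (Δ : UnitTriangle) : osc Δ ≠ 0 :=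
  div_ne_zero (side_ne_zero Δ _) (sq_div_sub_one_ne_zero Δ)

theorem norm_sq_mul_sub_one_add {a b : ℂ} (ha : ‖a‖ = 1) (hb : ‖b‖ = 1) :
    ‖a * b - 1‖ ^ 2 + ‖a * b⁻¹ - 1‖ ^ 2 =
      2 * ‖a - 1‖ ^ 2 + 2 * ‖b - 1‖ ^ 2 - ‖a - 1‖ ^ 2 * ‖b - 1‖ ^ 2 := by
  have hb' : b⁻¹ = conj b := by
    rw [Complex.inv_def, Complex.normSq_eq_norm_sq, hb]; simp
  have ha2 : a.re * a.re + a.im * a.im = 1 := by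
    rw [← Complex.normSq_apply, Complex.normSq_eq_norm_sq, ha, one_pow]
  have hb2 : b.re * b.re + b.im * b.im = 1 := by
    rw [← Complex.normSq_apply, Complex.normSq_eq_norm_sq, hb, one_pow]
  rw [hb']
  simp only [← Complex.normSq_eq_norm_sq, Complex.normSq_apply, Complex.sub_re, Complex.sub_im,
    Complex.mul_re, Complex.mul_im, Complex.one_re, Complex.one_im, Complex.conj_re,
    Complex.conj_im]
  linear_combination (3 * (b.re * b.re + b.im * b.im) - 1 - 2 * b.re) * ha2 + (2 - 2 * a.re) * hb2

/-- The squared norm satisfies the parallelogram law. For the chord lengths of a circle the law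
has a defect of favourable sign. -/
theorem defect_parallelogram (Δ : UnitTriangle) (x y : ℤ × ℤ) :
    defect Δ (x + y) + defect Δ (x - y) =
      2 * defect Δ x + 2 * defect Δ y + (‖osc Δ‖ ^ 2)⁻¹ * (oscSq Δ x * oscSq Δ y) := by
  have h0 : ‖osc Δ‖ ≠ 0 := norm_ne_zero_iff.2 (osc_ne_zero Δ)
  have h1 := norm_sq_mul_sub_one_add (a := f Δ x ^ 2) (b := f Δ y ^ 2) (by simp [norm_f])
    (by simp [norm_f])
  have h2 := parallelogram_law_with_norm ℝ (lattice Δ x) (lattice Δ y)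
  have h3 : lattice Δ (x + y) = lattice Δ x + lattice Δ y := by simp [lattice]; ring
  have h4 : f Δ (x + y) ^ 2 = f Δ x ^ 2 * f Δ y ^ 2 := by rw [f_add]; ring
  have h5 : f Δ (x - y) ^ 2 = f Δ x ^ 2 * (f Δ y ^ 2)⁻¹ := by
    rw [sub_eq_add_neg, f_add, f_neg]; ring
  simp only [defect, oscSq, h3, lattice_sub, h4, h5]
  have h6 : (‖osc Δ‖ ^ 2)⁻¹ * (‖osc Δ‖ ^ 2 * ‖f Δ x ^ 2 - 1‖ ^ 2 *
      (‖osc Δ‖ ^ 2 * ‖f Δ y ^ 2 - 1‖ ^ 2)) =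
      ‖osc Δ‖ ^ 2 * (‖f Δ x ^ 2 - 1‖ ^ 2 * ‖f Δ y ^ 2 - 1‖ ^ 2) := by field_simp
  rw [h6]
  linear_combination h2 - ‖osc Δ‖ ^ 2 * h1

theorem oscSq_edges (Δ : UnitTriangle) :
    oscSq Δ (1, 0) = len Δ .vertical ^ 2 ∧ oscSq Δ (0, 1) = len Δ .nwse ^ 2 ∧
      oscSq Δ (-1, 1) = len Δ .nesw ^ 2 := by
  have hs := side_sum Δ
  have h1 := osc_mul_right Δ
  have h2 := osc_mul_up Δ
  have hn : ‖dir Δ .nesw / dir Δ .nwse‖ = 1 := by simp [norm_dir]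
  have hn0 : dir Δ .nesw / dir Δ .nwse ≠ 0 := norm_ne_zero_iff.1 (by rw [hn]; exact one_ne_zero)
  refine ⟨?_, ?_, ?_⟩
  · rw [len, ← h1, oscSq, norm_mul, mul_pow]; simp [f]
  · rw [len, ← norm_neg, ← h2, oscSq, norm_mul, mul_pow]; simp [f]
  · have e : side Δ .nesw = osc Δ * (f Δ (-1, 1) ^ 2 - 1) * (dir Δ .nesw / dir Δ .nwse) ^ 2 := by
      have : f Δ (-1, 1) ^ 2 * (dir Δ .nesw / dir Δ .nwse) ^ 2 =
          (dir Δ .nesw / dir Δ .vertical) ^ 2 := by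
        simp only [f, zpow_neg_one, zpow_one]
        rw [← mul_pow]
        congr 1
        rw [mul_right_comm, inv_mul_cancel₀ hn0, one_mul]
      linear_combination hs - h2 + h1 - osc Δ * this
    rw [len, e, oscSq, norm_mul, norm_mul, norm_pow, hn, one_pow, mul_one, mul_pow]

theorem defect_neg (Δ : UnitTriangle) (x : ℤ × ℤ) : defect Δ (-x) = defect Δ x := by
  have e1 : lattice Δ (-x) = -lattice Δ x := by simp [lattice]; ring
  have e2 : ‖(f Δ x ^ 2)⁻¹ - 1‖ = ‖f Δ x ^ 2 - 1‖ := by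
    have h0 : f Δ x ^ 2 ≠ 0 := pow_ne_zero _ (f_ne_zero Δ x)
    have : f Δ x ^ 2 - 1 = -((f Δ x ^ 2)⁻¹ - 1) * f Δ x ^ 2 := by
      rw [neg_sub, sub_mul, inv_mul_cancel₀ h0, one_mul]
    rw [this, norm_mul, norm_neg, norm_pow, norm_f, one_pow, mul_one]
  rw [defect, defect, oscSq, oscSq, e1, norm_neg, f_neg, inv_pow, e2]

theorem defect_corner_sub_corner (Δ : UnitTriangle) (i : Fin 3) :
    defect Δ (corner i - corner (i + 1)) = 0 := by
  obtain ⟨h1, h2, h3⟩ := oscSq_edges Δ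
  have hs := side_sum Δ
  have e : lattice Δ (-1, 1) = side Δ .nesw := by
    simp only [lattice]; push_cast; linear_combination -hs
  fin_cases i
  · change defect Δ (corner 0 - corner 1) = 0
    rw [← defect_neg, show -(corner 0 - corner 1) = (1, 0) by decide, defect, h1]
    simp [lattice, len]
  · change defect Δ (corner 1 - corner 2) = 0
    rw [← defect_neg, show -(corner 1 - corner 2) = (-1, 1) by decide, defect, h3, e, len, sub_self]
  · change defect Δ (corner 2 - corner 0) = 0
    rw [show corner 2 - corner 0 = (0, 1) by decide, defect, h2]
    simp [lattice, len]

/-- Together with `defect_sub`: `2 ψ` minus its linear part contracts distances, strictly except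
between neighbours. -/
theorem defect_pos_or (Δ : UnitTriangle) (z : ℤ × ℤ) :
    0 < defect Δ z ∨ (defect Δ z = 0 ∧ (z = 0 ∨ ∃ i j, i ≠ j ∧ z = corner i - corner j)) := by
  obtain ⟨h1, h2, h3⟩ := oscSq_edges Δ
  refine pos_or_mem_of_parallelogram
    (inv_pos.2 (pow_pos (norm_pos_iff.2 (osc_ne_zero Δ)) 2)) (defect_parallelogram Δ)
    (fun x => by unfold oscSq; positivity) ?_ (defect_neg Δ) ?_ ?_ ?_ ?_ ?_ ?_ z
  · simp [defect, oscSq, lattice, f_zero]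
  · rw [← defect_neg]; simpa [corner] using defect_corner_sub_corner Δ 0
  · simpa [corner] using defect_corner_sub_corner Δ 2
  · rw [← defect_neg]; simpa [corner] using defect_corner_sub_corner Δ 1
  · rw [h1]; exact pow_pos (len_pos _ _) 2
  · rw [h2]; exact pow_pos (len_pos _ _) 2
  · rw [h3]; exact pow_pos (len_pos _ _) 2

theorem defect_sub (Δ : UnitTriangle) (lam : Circle) (z z' : ℤ × ℤ) :
    defect Δ (z - z') = 4 * (inner ℝ (psi Δ lam z - psi Δ lam z') (lattice Δ (z - z')) -
      ‖psi Δ lam z - psi Δ lam z'‖ ^ 2) := by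
  have h1 := two_mul_psi Δ lam z
  have h2 := two_mul_psi Δ lam z'
  have h3 : f Δ z ^ 2 = f Δ (z - z') ^ 2 * f Δ z' ^ 2 := by
    rw [← mul_pow, ← f_add, sub_add_cancel]
  have h4 : lattice Δ (z - z') - 2 * (psi Δ lam z - psi Δ lam z') =
      -((lam : ℂ) ^ 2 * osc Δ * (f Δ (z - z') ^ 2 - 1) * f Δ z' ^ 2) := by
    rw [lattice_sub]
    linear_combination h2 - h1 - (lam : ℂ) ^ 2 * osc Δ * h3
  have h5 : oscSq Δ (z - z') = ‖lattice Δ (z - z') - 2 * (psi Δ lam z - psi Δ lam z')‖ ^ 2 := by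
    rw [h4, norm_neg, norm_mul, norm_mul, norm_mul, norm_pow, norm_pow, norm_f, oscSq,
      Circle.norm_coe]
    ring
  rw [defect, h5]
  simp only [← Complex.normSq_eq_norm_sq, Complex.normSq_apply, Complex.inner, Complex.sub_re,
    Complex.sub_im, Complex.mul_re, Complex.mul_im, Complex.conj_re, Complex.conj_im]
  norm_num
  ring

/-! ### Vertices and segments of the T-graph -/

theorem ratio_ne_zero {Δ : UnitTriangle} {lam : Circle} (h : Nondegenerate Δ lam) (w : ℤ × ℤ) :
    ratio Δ lam w ≠ 0 := by
  intro hr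
  refine h.1 w ?_
  have h0 := psi_corner_succ Δ lam w 0
  have h2 := psi_corner_succ Δ lam w 2
  rw [hr, Complex.ofReal_zero, mul_zero, sub_eq_zero] at h0 h2
  have h0' : psi Δ lam (w.1 + 1, w.2) = psi Δ lam (w.1, w.2) := by
    simpa [corner, Prod.add_def] using h0
  have h2' : psi Δ lam (w.1, w.2) = psi Δ lam (w.1, w.2 + 1) := by
    simpa [corner, Prod.add_def] using h2
  rw [face, h0', ← h2']
  simp

/-- If `z` is a corner of a black face whose two other corners are `z + corner i - corner k`,
`k ≠ i`, this is a unit vector in the direction of the segment which is its image. -/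
noncomputable def axis (Δ : UnitTriangle) (lam : Circle) (z : ℤ × ℤ) (i : Fin 3) : ℂ :=
  (lam : ℂ) * f Δ z / dir Δ .nesw * dir Δ (opp (i + 1)) * dir Δ (opp (i + 2))

theorem norm_axis (Δ : UnitTriangle) (lam : Circle) (z : ℤ × ℤ) (i : Fin 3) :
    ‖axis Δ lam z i‖ = 1 := by
  simp [axis, norm_dir, norm_f, Circle.norm_coe]

theorem f_sub_corner (Δ : UnitTriangle) (z : ℤ × ℤ) (k : Fin 3) :
    f Δ (z - corner k) = f Δ z * dir Δ (opp k) / dir Δ .nesw := by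
  rw [sub_eq_add_neg, f_add, f_neg, f_corner, inv_div, mul_div_assoc]

/-- The edge from `z` to another corner of the black face missing the index `i`, seen from the
white face `z - corner (i + 1)`. -/
theorem psi_step_one (Δ : UnitTriangle) (lam : Circle) (z : ℤ × ℤ) (i : Fin 3) :
    psi Δ lam (z + corner i - corner (i + 1)) - psi Δ lam z =
      ((-(len Δ (opp (i + 2)) * ratio Δ lam (z - corner (i + 1))) : ℝ) : ℂ) * axis Δ lam z i := by
  have h := psi_corner_succ Δ lam (z - corner (i + 1)) i
  rw [sub_add_cancel, f_sub_corner, ← len_mul_dir,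
    show z - corner (i + 1) + corner i = z + corner i - corner (i + 1) by abel] at h
  rw [axis]
  push_cast
  linear_combination -h

/-- The edge from `z` to another corner of the black face missing the index `i`, seen from the
white face `z - corner (i + 2)`. -/
theorem psi_step_two (Δ : UnitTriangle) (lam : Circle) (z : ℤ × ℤ) (i : Fin 3) :
    psi Δ lam (z + corner i - corner (i + 2)) - psi Δ lam z =
      ((len Δ (opp (i + 1)) * ratio Δ lam (z - corner (i + 2)) : ℝ) : ℂ) * axis Δ lam z i := by
  have h := psi_corner_succ Δ lam (z - corner (i + 2)) (i + 2)
  rw [sub_add_cancel, f_sub_corner, ← len_mul_dir,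
    show i + 2 + 1 = i by rw [add_assoc]; exact add_zero i,
    show i + 2 + 2 = i + 1 by rw [add_assoc]; rfl,
    show z - corner (i + 2) + corner i = z + corner i - corner (i + 2) by abel] at h
  rw [axis]
  push_cast
  linear_combination h

/-- The contraction ratios of the three faces which meet at a vertex. -/
theorem sum_len_mul_ratio (Δ : UnitTriangle) (lam : Circle) (z : ℤ × ℤ) :
    ∑ i, len Δ (opp i) * ratio Δ lam (z - corner i) = 0 := by
  have h := side_sum Δ
  rw [← len_mul_dir, ← len_mul_dir, ← len_mul_dir] at h
  have h1 : ∑ i, (len Δ (opp i) : ℂ) * ((lam : ℂ) * f Δ (z - corner i)) = 0 := by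
    simp only [f_sub_corner, Fin.sum_univ_three]
    simp only [opp, Matrix.cons_val]
    linear_combination ((lam : ℂ) * f Δ z / dir Δ .nesw) * h
  have h2 := congrArg Complex.re h1
  rw [Complex.re_sum, Complex.zero_re] at h2
  rw [← h2]
  exact Finset.sum_congr rfl fun i _ => by rw [Complex.re_ofReal_mul, ratio]

theorem exists_mul_pos {x : Fin 3 → ℝ} (hx : ∀ i, x i ≠ 0) : ∃ i, 0 < x (i + 1) * x (i + 2) := by
  rcases lt_or_gt_of_ne (hx 0) with h0 | h0 <;> rcases lt_or_gt_of_ne (hx 1) with h1 | h1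
  · exact ⟨2, mul_pos_of_neg_of_neg h0 h1⟩
  · rcases lt_or_gt_of_ne (hx 2) with h2 | h2
    · exact ⟨1, mul_pos_of_neg_of_neg h2 h0⟩
    · exact ⟨0, mul_pos h1 h2⟩
  · rcases lt_or_gt_of_ne (hx 2) with h2 | h2
    · exact ⟨0, mul_pos_of_neg_of_neg h1 h2⟩
    · exact ⟨1, mul_pos h2 h0⟩
  · exact ⟨2, mul_pos h0 h1⟩

/-- If a positive combination of three numbers vanishes, only one pair has equal signs. -/
theorem eq_of_mul_pos_of_sum_eq_zero {l x : Fin 3 → ℝ} (hl : ∀ i, 0 < l i)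
    (h : ∑ i, l i * x i = 0) {i j : Fin 3} (hi : 0 < x (i + 1) * x (i + 2))
    (hj : 0 < x (j + 1) * x (j + 2)) : i = j := by
  have key : ∀ i, 0 < x (i + 1) * x (i + 2) → x i * x (i + 1) < 0 ∧ x i * x (i + 2) < 0 := by
    intro i hi
    have e : l i * x i + l (i + 1) * x (i + 1) + l (i + 2) * x (i + 2) = 0 := by
      rw [Fin.sum_univ_three] at h
      fin_cases i <;> simp at * <;> linarith
    have a0 := hl i
    have a1 := hl (i + 1)
    have a2 := hl (i + 2)
    rcases (mul_pos_iff.1 hi) with ⟨p, p'⟩ | ⟨p, p'⟩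
    · have : x i < 0 := by
        by_contra hc
        push Not at hc
        have := mul_nonneg a0.le hc
        have := mul_pos a1 p
        have := mul_pos a2 p'
        linarith
      exact ⟨mul_neg_of_neg_of_pos this p, mul_neg_of_neg_of_pos this p'⟩
    · have : 0 < x i := by
        by_contra hc
        push Not at hc
        have := mul_nonpos_of_nonneg_of_nonpos a0.le hc
        have := mul_neg_of_pos_of_neg a1 p
        have := mul_neg_of_pos_of_neg a2 p'
        linarith
      exact ⟨mul_neg_of_pos_of_neg this p, mul_neg_of_pos_of_neg this p'⟩
  have hk := key i hi
  by_contra hij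
  fin_cases i <;> fin_cases j <;> simp at * <;> nlinarith

/-- The vertex `ψ z` lies between the images of the two other corners of the black face with
corners `z + corner i - corner k`: the two adjacent white faces have ratios of the same sign, see
`IsMid.mem_openSegment`. -/
def IsMid (Δ : UnitTriangle) (lam : Circle) (z : ℤ × ℤ) (i : Fin 3) : Prop :=
  0 < ratio Δ lam (z - corner (i + 1)) * ratio Δ lam (z - corner (i + 2))

theorem exists_isMid {Δ : UnitTriangle} {lam : Circle} (h : Nondegenerate Δ lam) (z : ℤ × ℤ) :
    ∃ i, IsMid Δ lam z i :=
  exists_mul_pos (x := fun i => ratio Δ lam (z - corner i)) fun _ => ratio_ne_zero h _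

theorem IsMid.eq {Δ : UnitTriangle} {lam : Circle} {z : ℤ × ℤ} {i j : Fin 3}
    (hi : IsMid Δ lam z i) (hj : IsMid Δ lam z j) : i = j :=
  eq_of_mul_pos_of_sum_eq_zero (l := fun i => len Δ (opp i))
    (x := fun i => ratio Δ lam (z - corner i))
    (fun i => len_pos Δ (opp i)) (sum_len_mul_ratio Δ lam z) hi hj

/-- Every black face has a corner which is mapped between the two others. -/
theorem exists_isMid_of_black {Δ : UnitTriangle} {lam : Circle} (h : Nondegenerate Δ lam)
    (b : ℤ × ℤ) : ∃ z i, IsMid Δ lam z i ∧ b = z + corner i - corner 1 := by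
  obtain ⟨i, hi⟩ := exists_mul_pos
    (x := fun i => ratio Δ lam (b + corner 1 - corner (i + 1) - corner (i + 2)))
    fun _ => ratio_ne_zero h _
  refine ⟨b + corner 1 - corner i, i, ?_, by abel⟩
  have e1 : i + 1 + 2 = i := by rw [add_assoc]; exact add_zero i
  have e2 : i + 2 + 1 = i := by rw [add_assoc]; exact add_zero i
  have e3 : i + 2 + 2 = i + 1 := by rw [add_assoc]; rfl
  have e4 : i + 1 + 1 = i + 2 := by rw [add_assoc]; rfl
  simp only [e1, e2, e3, e4] at hi
  unfold IsMid
  rwa [sub_right_comm _ (corner i) (corner (i + 2)), mul_comm]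

theorem range_fin_three {X : Type*} (g : Fin 3 → X) (i : Fin 3) :
    Set.range g = {g (i + 1), g (i + 2), g i} := by
  ext y
  fin_cases i <;> simp [Fin.exists_fin_succ, eq_comm] <;> tauto

theorem seg_eq_range (Δ : UnitTriangle) (lam : Circle) (b : ℤ × ℤ) :
    seg Δ lam b = convexHull ℝ (Set.range fun k => psi Δ lam (b + corner 1 - corner k)) := by
  rw [range_fin_three _ 0, seg]
  congr 1
  obtain ⟨m, n⟩ := b
  simp only [corner]
  simp [Set.pair_comm]

theorem convexHull_insert_eq_segment {x y z : ℂ} (hz : z ∈ segment ℝ x y) :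
    convexHull ℝ {x, y, z} = segment ℝ x y := by
  refine Set.Subset.antisymm (convexHull_min ?_ (convex_segment x y)) ?_
  · rintro w (rfl | rfl | rfl)
    · exact left_mem_segment ℝ _ _
    · exact right_mem_segment ℝ _ _
    · exact hz
  · rw [← convexHull_pair]
    exact convexHull_mono (by intro w; simp; tauto)

theorem IsMid.mem_openSegment {Δ : UnitTriangle} {lam : Circle} {z : ℤ × ℤ} {i : Fin 3}
    (h : IsMid Δ lam z i) :
    psi Δ lam z ∈ openSegment ℝ (psi Δ lam (z + corner i - corner (i + 1)))
      (psi Δ lam (z + corner i - corner (i + 2))) := by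
  have h1 := psi_step_one Δ lam z i
  have h2 := psi_step_two Δ lam z i
  have a1 := len_pos Δ (opp (i + 1))
  have a2 := len_pos Δ (opp (i + 2))
  unfold IsMid at h
  set r1 := ratio Δ lam (z - corner (i + 1))
  set r2 := ratio Δ lam (z - corner (i + 2))
  set l1 := len Δ (opp (i + 1))
  set l2 := len Δ (opp (i + 2))
  have hpos : 0 < l1 * |r2| + l2 * |r1| := by
    have := abs_pos.2 (left_ne_zero_of_mul h.ne')
    have := abs_pos.2 (right_ne_zero_of_mul h.ne')
    positivity
  refine ⟨l1 * |r2| / (l1 * |r2| + l2 * |r1|), l2 * |r1| / (l1 * |r2| + l2 * |r1|), ?_, ?_, ?_, ?_⟩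
  · have := abs_pos.2 (right_ne_zero_of_mul h.ne'); positivity
  · have := abs_pos.2 (left_ne_zero_of_mul h.ne'); positivity
  · field_simp
  · have hr : |r2| * r1 = |r1| * r2 := by
      rcases mul_pos_iff.1 h with ⟨p, q⟩ | ⟨p, q⟩
      · rw [abs_of_pos p, abs_of_pos q, mul_comm]
      · rw [abs_of_neg p, abs_of_neg q]; ring
    have hr' : ((|r2| : ℝ) : ℂ) * r1 = (|r1| : ℝ) * r2 := by exact_mod_cast hr
    have hpos' : ((l1 * |r2| + l2 * |r1| : ℝ) : ℂ) ≠ 0 := by exact_mod_cast hpos.ne'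
    rw [Complex.real_smul, Complex.real_smul, sub_eq_iff_eq_add.1 h1, sub_eq_iff_eq_add.1 h2]
    push_cast at hpos' ⊢
    field_simp
    linear_combination (-(l1 : ℂ) * l2 * axis Δ lam z i) * hr'

theorem IsMid.isInterior {Δ : UnitTriangle} {lam : Circle} {z : ℤ × ℤ} {i : Fin 3}
    (h : IsMid Δ lam z i) :
    IsInterior Δ lam (z + corner i - corner 1) (psi Δ lam (z + corner i - corner (i + 1)))
      (psi Δ lam (z + corner i - corner (i + 2))) (psi Δ lam z) := by
  refine ⟨?_, ?_, h.mem_openSegment⟩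
  · intro he
    have h1 := h.mem_openSegment
    rw [← he, openSegment_same, Set.mem_singleton_iff, ← sub_eq_zero, ← neg_sub, neg_eq_zero,
      psi_step_one] at h1
    have h2 : axis Δ lam z i ≠ 0 := norm_ne_zero_iff.1 (by rw [norm_axis]; exact one_ne_zero)
    have h3 := (mul_eq_zero.1 h1).resolve_right h2
    rw [Complex.ofReal_eq_zero, neg_eq_zero] at h3
    exact left_ne_zero_of_mul (ne_of_gt h) ((mul_eq_zero.1 h3).resolve_left (len_pos Δ _).ne')
  · rw [seg_eq_range, range_fin_three _ i]
    simp only [sub_add_cancel, add_sub_cancel_right]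
    exact convexHull_insert_eq_segment (openSegment_subset_segment _ _ _ h.mem_openSegment)

/-- If two vertices coincided, they would be neighbours, and a face would be reduced to a point. -/
theorem psi_injective {Δ : UnitTriangle} {lam : Circle} (h : Nondegenerate Δ lam) :
    Function.Injective (psi Δ lam) := by
  intro z z' hz
  have h1 := defect_sub Δ lam z z'
  rw [hz, sub_self, inner_zero_left, norm_zero] at h1
  norm_num at h1
  rcases defect_pos_or Δ (z - z') with h2 | ⟨-, h2 | ⟨i, j, hij, h2⟩⟩
  · exact absurd h1 h2.ne'
  · exact sub_eq_zero.1 h2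
  · exfalso
    have key : ∀ (w : ℤ × ℤ) (k : Fin 3),
        psi Δ lam (w + corner (k + 1)) ≠ psi Δ lam (w + corner k) := by
      intro w k he
      have := psi_corner_succ Δ lam w k
      rw [he, sub_self] at this
      have h3 : (lam : ℂ) * f Δ w ≠ 0 := mul_ne_zero (Circle.coe_ne_zero lam) (f_ne_zero Δ w)
      exact mul_ne_zero (mul_ne_zero (side_ne_zero Δ _) h3)
        (Complex.ofReal_ne_zero.2 (ratio_ne_zero h w)) this.symm
    have e1 : z = (z' - corner j) + corner i := by
      rw [sub_add_eq_add_sub, add_sub_assoc, ← h2]; abel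
    have e2 : z' = (z' - corner j) + corner j := by abel
    have hc : i = j + 1 ∨ j = i + 1 := by clear * - hij; revert i j; decide
    rcases hc with rfl | rfl
    · exact key (z' - corner j) j (by rw [← e1, ← e2, hz])
    · exact key (z' - corner (i + 1)) i (by rw [← e1, ← e2, hz])

/-- A vertex in the interior of the image of a black face is the image of a corner of it. -/
theorem eq_of_mem_openSegment {Δ : UnitTriangle} {lam : Circle} (h : Nondegenerate Δ lam)
    {c z : ℤ × ℤ} {i : Fin 3}
    (hz : psi Δ lam z ∈ openSegment ℝ (psi Δ lam (c + corner i - corner (i + 1)))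
      (psi Δ lam (c + corner i - corner (i + 2)))) (hm : IsMid Δ lam c i) : z = c := by
  set x0 := c + corner i - corner (i + 1) with hx0
  set x1 := c + corner i - corner (i + 2) with hx1
  obtain ⟨s, t, hs, ht, hst, hp⟩ := hz
  have hs' : s = 1 - t := by linarith
  set e := psi Δ lam x1 - psi Δ lam x0 with he
  have hne : psi Δ lam x0 ≠ psi Δ lam x1 := hm.isInterior.1
  have p0 : psi Δ lam z - psi Δ lam x0 = t • e := by
    rw [← hp, he, hs']; module
  have p1 : psi Δ lam z - psi Δ lam x1 = (-s) • e := by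
    rw [← hp, he, hs']; module
  have d0 := defect_sub Δ lam z x0
  have d1 := defect_sub Δ lam z x1
  have d2 := defect_sub Δ lam x1 x0
  have l1 : lattice Δ (z - x1) = lattice Δ (z - x0) - lattice Δ (x1 - x0) := by
    rw [← lattice_sub]; congr 1; abel
  have hd2 : defect Δ (x1 - x0) = 0 := by
    have : x1 - x0 = corner (i + 1) - corner (i + 2) := by rw [hx0, hx1]; abel
    have h3 := defect_corner_sub_corner Δ (i + 1)
    rwa [show i + 1 + 1 = i + 2 by rw [add_assoc]; rfl, ← this] at h3
  rw [p0, inner_smul_left, norm_smul, mul_pow, Real.norm_eq_abs, sq_abs] at d0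
  rw [p1, l1, inner_smul_left, inner_sub_right, norm_smul, mul_pow, Real.norm_eq_abs, sq_abs] at d1
  rw [← he, hd2] at d2
  simp only [conj_trivial] at d0 d1
  -- both defects are nonnegative, so both vanish
  have hsum : s * defect Δ (z - x0) + t * defect Δ (z - x1) = 0 := by
    rw [d0, d1, hs']
    linear_combination (-(1 - t) * t) * d2
  have nb : ∀ x, psi Δ lam z ≠ psi Δ lam x → defect Δ (z - x) ≤ 0 →
      ∃ a b, a ≠ b ∧ z - x = corner a - corner b := by
    intro x hx hd
    rcases defect_pos_or Δ (z - x) with h2 | ⟨-, h2 | h2⟩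
    · exact absurd hd (not_le.2 h2)
    · exact absurd (by rw [sub_eq_zero.1 h2]) hx
    · exact h2
  have nonneg : ∀ y, 0 ≤ defect Δ y := fun y => by
    rcases defect_pos_or Δ y with h2 | ⟨h2, -⟩
    · exact h2.le
    · exact h2.ge
  have he0 : e ≠ 0 := sub_ne_zero.2 hne.symm
  obtain ⟨a, a', haa, ha⟩ := nb x0 (by
    rw [← sub_ne_zero, p0]; exact smul_ne_zero ht.ne' he0)
    (by nlinarith [nonneg (z - x0), nonneg (z - x1)])
  obtain ⟨b, b', hbb, hb⟩ := nb x1 (by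
    rw [← sub_ne_zero, p1]; exact smul_ne_zero (neg_ne_zero.2 hs.ne') he0)
    (by nlinarith [nonneg (z - x0), nonneg (z - x1)])
  -- the only common neighbours of the endpoints are `c` and its mirror image, the third corner
  -- of the white face on the other side
  have hcases : z - c = 0 ∨ z - c = corner i - corner (i + 1) - corner (i + 2) + corner i := by
    have e1 : z - c = corner i - corner (i + 1) + (corner a - corner a') := by
      rw [← ha, hx0]; abel
    have e2 : z - c = corner i - corner (i + 2) + (corner b - corner b') := by
      rw [← hb, hx1]; abel
    have e3 := e1.symm.trans e2
    rw [e1]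
    clear * - haa hbb e3
    revert i a a' b b'
    decide
  rcases hcases with h2 | h2
  · exact sub_eq_zero.1 h2
  exfalso
  set w := x0 - corner (i + 2) with hw
  have w0 : w + corner i = z := by rw [hw, hx0, ← sub_add_cancel z c, h2]; abel
  have w1 : w + corner (i + 1) = x1 := by rw [hw, hx0, hx1]; abel
  have w2 : w + corner (i + 2) = x0 := by rw [hw]; abel
  have s1 := psi_corner_succ Δ lam w i
  have s2 := psi_corner_succ Δ lam w (i + 1)
  rw [show i + 1 + 2 = i by rw [add_assoc]; exact add_zero i,
    show i + 1 + 1 = i + 2 by rw [add_assoc]; rfl, w1, w2] at s2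
  rw [w0, w1] at s1
  set Q := (lam : ℂ) * f Δ w with hQ
  have hQ0 : Q * ratio Δ lam w ≠ 0 :=
    mul_ne_zero (mul_ne_zero (Circle.coe_ne_zero lam) (f_ne_zero Δ w))
      (Complex.ofReal_ne_zero.2 (ratio_ne_zero h w))
  have hlin : side Δ (opp (i + 2)) = (-s : ℝ) * side Δ (opp i) := by
    refine mul_right_cancel₀ hQ0 ?_
    rw [Complex.real_smul] at p1
    linear_combination -s1 - p1 + ((-s : ℝ) : ℂ) * s2 - ((-s : ℝ) : ℂ) * he
  have hcross := cross_side Δ (i + 2)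
  rw [show i + 2 + 1 = i by rw [add_assoc]; exact add_zero i, hlin, map_mul, Complex.conj_ofReal,
    mul_assoc, Complex.im_ofReal_mul, mul_comm (conj _), Complex.mul_conj,
    Complex.ofReal_im] at hcross
  norm_num at hcross

/-! ### Transversality of consecutive segments -/

theorem eq_of_segment_eq_segment {x y a b : ℂ} (hxy : x ≠ y) (h : segment ℝ x y = segment ℝ a b) :
    (x = a ∧ y = b) ∨ (x = b ∧ y = a) := by
  have hx : x ∈ segment ℝ a b := h ▸ left_mem_segment ℝ x y
  have hy : y ∈ segment ℝ a b := h ▸ right_mem_segment ℝ x y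
  have ha : a ∈ segment ℝ x y := h ▸ left_mem_segment ℝ a b
  have hb : b ∈ segment ℝ x y := h ▸ right_mem_segment ℝ a b
  rw [segment_eq_image'] at hx hy ha hb
  obtain ⟨s, ⟨hs0, hs1⟩, rfl⟩ := hx
  obtain ⟨t, ⟨ht0, ht1⟩, rfl⟩ := hy
  obtain ⟨s', ⟨hs0', hs1'⟩, ea⟩ := ha
  obtain ⟨t', ⟨ht0', ht1'⟩, eb⟩ := hb
  simp only at ea eb hxy ⊢
  have hab : b - a ≠ 0 := by
    intro h0; rw [h0] at hxy; simp at hxy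
  have e : (((t' - s') * (t - s) - 1 : ℝ)) • (b - a) = 0 := by
    have : (t' - s') • ((a + t • (b - a)) - (a + s • (b - a))) = b - a := by
      rw [← sub_eq_zero]
      have e1 : b - a = (a + s • (b - a) + t' • (a + t • (b - a) - (a + s • (b - a)))) -
        (a + s • (b - a) + s' • (a + t • (b - a) - (a + s • (b - a)))) := by rw [ea, eb]
      rw [sub_eq_zero]
      conv_rhs => rw [e1]
      module
    rw [sub_smul, one_smul, sub_eq_zero]
    conv_rhs => rw [← this]
    module
  have e' := (smul_eq_zero.1 e).resolve_right hab
  have : (s = 0 ∧ t = 1) ∨ (s = 1 ∧ t = 0) := by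
    rcases le_total s t with hst | hst
    · left
      constructor <;> nlinarith
    · right
      constructor <;> nlinarith
  rcases this with ⟨rfl, rfl⟩ | ⟨rfl, rfl⟩
  · left; simp
  · right; simp

/-- A vertex is in the interior of one segment only. -/
theorem IsInterior.eq_endpoints {Δ : UnitTriangle} {lam : Circle} (h : Nondegenerate Δ lam)
    {b z : ℤ × ℤ} {x y : ℂ} {i : Fin 3} (hb : IsInterior Δ lam b x y (psi Δ lam z))
    (hm : IsMid Δ lam z i) :
    (x = psi Δ lam (z + corner i - corner (i + 1)) ∧
      y = psi Δ lam (z + corner i - corner (i + 2))) ∨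
    (x = psi Δ lam (z + corner i - corner (i + 2)) ∧
      y = psi Δ lam (z + corner i - corner (i + 1))) := by
  obtain ⟨c, j, hc, rfl⟩ := exists_isMid_of_black h b
  obtain ⟨hxy, hseg, hz⟩ := hb
  have hs := hseg.symm.trans hc.isInterior.2.1
  have hxy' := eq_of_segment_eq_segment hxy hs
  have hz' : psi Δ lam z ∈ openSegment ℝ (psi Δ lam (c + corner j - corner (j + 1)))
      (psi Δ lam (c + corner j - corner (j + 2))) := by
    rcases hxy' with ⟨rfl, rfl⟩ | ⟨rfl, rfl⟩
    · exact hz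
    · rwa [openSegment_symm]
  have hzc := eq_of_mem_openSegment h hz' hc
  subst hzc
  rw [hc.eq hm] at hxy'
  exact hxy'

theorem axis_mul_dir (Δ : UnitTriangle) (lam : Circle) (z : ℤ × ℤ) (i : Fin 3) :
    axis Δ lam z i * dir Δ (opp i) = (lam : ℂ) * f Δ z / dir Δ .nesw *
      (dir Δ .nesw * dir Δ .nwse * dir Δ .vertical) := by
  fin_cases i <;> simp [axis, opp] <;> ring

/-- The axis does not depend on the corner of the black face from which it is computed. -/
theorem axis_one (Δ : UnitTriangle) (lam : Circle) (z : ℤ × ℤ) (i : Fin 3) :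
    axis Δ lam (z + corner i - corner (i + 1)) (i + 1) = axis Δ lam z i := by
  have hd := dir_ne_zero Δ (opp i)
  have hn := dir_ne_zero Δ .nesw
  rw [axis, axis, f_sub_corner, f_add, f_corner, show i + 1 + 2 = i by
    rw [add_assoc]; exact add_zero i, show i + 1 + 1 = i + 2 by rw [add_assoc]; rfl]
  field_simp

theorem axis_two (Δ : UnitTriangle) (lam : Circle) (z : ℤ × ℤ) (i : Fin 3) :
    axis Δ lam (z + corner i - corner (i + 2)) (i + 2) = axis Δ lam z i := by
  have hd := dir_ne_zero Δ (opp i)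
  have hn := dir_ne_zero Δ .nesw
  rw [axis, axis, f_sub_corner, f_add, f_corner, show i + 2 + 1 = i by
    rw [add_assoc]; exact add_zero i, show i + 2 + 2 = i + 1 by rw [add_assoc]; rfl]
  field_simp

/-- The endpoints of a segment are in the interior of another one. -/
theorem IsMid.not_isMid {Δ : UnitTriangle} {lam : Circle} (h : Nondegenerate Δ lam) {z : ℤ × ℤ}
    {i : Fin 3} (hm : IsMid Δ lam z i) :
    ¬ IsMid Δ lam (z + corner i - corner (i + 1)) (i + 1) ∧
      ¬ IsMid Δ lam (z + corner i - corner (i + 2)) (i + 2) := by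
  have hne : ∀ k, k ≠ i → psi Δ lam z ≠ psi Δ lam (z + corner i - corner k) := by
    intro k hk he
    have h1 := psi_injective h he
    have h2 : corner i = corner k := by
      have h3 : z + 0 = z + (corner i - corner k) := by rw [add_zero, ← add_sub_assoc]; exact h1
      exact (sub_eq_zero.1 (add_left_cancel h3).symm)
    clear * - hk h2
    revert i k
    decide
  have h1 : i + 1 ≠ i := by clear * -; revert i; decide
  have h2 : i + 2 ≠ i := by clear * -; revert i; decide
  obtain ⟨-, hs, -⟩ := hm.isInterior
  refine ⟨fun hc => ?_, fun hc => ?_⟩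
  · have hI := hc.isInterior
    rw [IsInterior, sub_add_cancel, hs, show i + 1 + 2 = i by rw [add_assoc]; exact add_zero i,
      show i + 1 + 1 = i + 2 by rw [add_assoc]; rfl, add_sub_cancel_right] at hI
    rcases eq_of_segment_eq_segment hI.1 hI.2.1.symm with ⟨e1, e2⟩ | ⟨e1, e2⟩
    · exact hne _ h2 e2
    · exact hne _ h1 e2
  · have hI := hc.isInterior
    rw [IsInterior, sub_add_cancel, hs, show i + 2 + 1 = i by rw [add_assoc]; exact add_zero i,
      show i + 2 + 2 = i + 1 by rw [add_assoc]; rfl, add_sub_cancel_right] at hI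
    rcases eq_of_segment_eq_segment hI.1 hI.2.1.symm with ⟨e1, e2⟩ | ⟨e1, e2⟩
    · exact hne _ h1 e1
    · exact hne _ h2 e1

section Bounds

variable {Δ : UnitTriangle} {D : ℝ}

theorem two_le_len_mul_len (Δ : UnitTriangle) (i : Fin 3) :
    2 ≤ len Δ (opp i) * len Δ (opp (i + 1)) := by
  have h := Complex.abs_im_le_norm (conj (side Δ (opp i)) * side Δ (opp (i + 1)))
  rw [cross_side, norm_mul, Complex.norm_conj, abs_two] at h
  exact h

theorem bound_pos (hD : ∀ e, len Δ e ≤ D) : 0 < D :=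
  (len_pos Δ .vertical).trans_le (hD _)

theorem two_le_bound_sq (hD : ∀ e, len Δ e ≤ D) : 2 ≤ D ^ 2 := by
  have h := two_le_len_mul_len Δ 0
  have := mul_le_mul (hD (opp 0)) (hD (opp (0 + 1))) (len_pos Δ _).le (bound_pos hD).le
  linarith

theorem two_div_le_len (hD : ∀ e, len Δ e ≤ D) (i : Fin 3) : 2 / D ≤ len Δ (opp i) := by
  rw [div_le_iff₀ (bound_pos hD)]
  exact (two_le_len_mul_len Δ i).trans (mul_le_mul_of_nonneg_left (hD _) (len_pos Δ _).le)

theorem two_div_le_cross_dir (hD : ∀ e, len Δ e ≤ D) {i j : Fin 3} (hij : i ≠ j) :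
    2 / D ^ 2 ≤ |(conj (dir Δ (opp i)) * dir Δ (opp j)).im| := by
  have key : ∀ i, 2 / D ^ 2 ≤ |(conj (dir Δ (opp i)) * dir Δ (opp (i + 1))).im| := by
    intro i
    have h := cross_side Δ i
    rw [← len_mul_dir, ← len_mul_dir, map_mul, Complex.conj_ofReal, mul_mul_mul_comm,
      ← Complex.ofReal_mul, Complex.im_ofReal_mul] at h
    have h1 := len_pos Δ (opp i)
    have h2 := len_pos Δ (opp (i + 1))
    have h3 : len Δ (opp i) * len Δ (opp (i + 1)) ≤ D ^ 2 := by
      rw [sq]; exact mul_le_mul (hD _) (hD _) h2.le (bound_pos hD).le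
    refine le_trans ?_ (le_abs_self _)
    rw [← h, div_le_iff₀ (pow_pos (bound_pos hD) 2), mul_comm]
    refine mul_le_mul_of_nonneg_left h3 ?_
    by_contra hc
    push Not at hc
    have := mul_neg_of_pos_of_neg (mul_pos h1 h2) hc
    linarith
  have hc : j = i + 1 ∨ i = j + 1 := by clear * - hij; revert i j; decide
  rcases hc with rfl | rfl
  · exact key i
  · have e : (conj (dir Δ (opp (j + 1))) * dir Δ (opp j)).im =
        -(conj (dir Δ (opp j)) * dir Δ (opp (j + 1))).im := by
      simp only [Complex.mul_im, Complex.conj_re, Complex.conj_im]; ring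
    rw [e, abs_neg]
    exact key j

theorem ratio_sub_corner (Δ : UnitTriangle) (lam : Circle) (z : ℤ × ℤ) (k : Fin 3) :
    ratio Δ lam (z - corner k) = ((lam : ℂ) * f Δ z / dir Δ .nesw * dir Δ (opp k)).re := by
  rw [ratio, f_sub_corner]; congr 1; ring

theorem abs_cross_le {x y : ℂ} (hx : ‖x‖ = 1) (hy : ‖y‖ = 1) :
    |(conj x * y).im| ≤ |x.re| + |y.re| := by
  have h1 := Complex.abs_im_le_norm x
  have h2 := Complex.abs_im_le_norm y
  rw [hx] at h1
  rw [hy] at h2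
  simp only [Complex.mul_im, Complex.conj_re, Complex.conj_im]
  calc |x.re * y.im + -x.im * y.re| ≤ |x.re| * |y.im| + |x.im| * |y.re| := by
        refine (abs_add_le _ _).trans ?_
        rw [abs_mul, abs_mul, abs_neg]
    _ ≤ |x.re| * 1 + 1 * |y.re| := by gcongr
    _ = _ := by ring

/-- At most one of the faces at a vertex is small. -/
theorem two_div_le_abs_ratio_add (hD : ∀ e, len Δ e ≤ D) (lam : Circle) (z : ℤ × ℤ) {i j : Fin 3}
    (hij : i ≠ j) :
    2 / D ^ 2 ≤ |ratio Δ lam (z - corner i)| + |ratio Δ lam (z - corner j)| := by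
  rw [ratio_sub_corner, ratio_sub_corner]
  set p := (lam : ℂ) * f Δ z / dir Δ .nesw with hp
  have hp1 : ‖p‖ = 1 := by simp [hp, norm_f, norm_dir, Circle.norm_coe]
  refine le_trans ?_ (abs_cross_le (by rw [norm_mul, hp1, norm_dir, one_mul])
    (by rw [norm_mul, hp1, norm_dir, one_mul]))
  refine (two_div_le_cross_dir hD hij).trans (le_of_eq ?_)
  have : conj (p * dir Δ (opp i)) * (p * dir Δ (opp j)) = (conj p * p) *
      (conj (dir Δ (opp i)) * dir Δ (opp j)) := by rw [map_mul]; ring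
  rw [this, Complex.conj_mul', hp1]
  simp

/-- A unit vector is not nearly orthogonal to two transversal ones. -/
theorem sq_cross_le {n x y : ℂ} (hn : ‖n‖ = 1) (hx : ‖x‖ = 1) (hy : ‖y‖ = 1) :
    |(conj x * y).im| ^ 2 / 2 ≤ inner ℝ n x ^ 2 + inner ℝ n y ^ 2 := by
  have h := abs_cross_le (x := conj n * x) (y := conj n * y) (by simp [hn, hx]) (by simp [hn, hy])
  have e : conj (conj n * x) * (conj n * y) = conj x * y := by
    have : conj n * n = 1 := by rw [Complex.conj_mul', hn]; simp
    rw [map_mul, Complex.conj_conj]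
    linear_combination (conj x * y) * this
  have e' : ∀ w, inner ℝ n w = (conj n * w).re := fun w => by rw [Complex.inner, mul_comm]
  rw [e, ← e', ← e'] at h
  have h0 := abs_nonneg (conj x * y).im
  have h1 : |(conj x * y).im| ^ 2 ≤ (|inner ℝ n x| + |inner ℝ n y|) ^ 2 := by gcongr
  have h2 := sq_nonneg (|inner ℝ n x| - |inner ℝ n y|)
  have h3 := sq_abs (inner ℝ n x)
  have h4 := sq_abs (inner ℝ n y)
  nlinarith

theorem two_div_le_inner_axis (hD : ∀ e, len Δ e ≤ D) (lam : Circle) (z : ℤ × ℤ) {i j : Fin 3}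
    (hij : i ≠ j) {n : ℂ} (hn : ‖n‖ = 1) :
    2 / D ^ 4 ≤ inner ℝ n (axis Δ lam z i) ^ 2 + inner ℝ n (axis Δ lam z j) ^ 2 := by
  refine le_trans ?_ (sq_cross_le hn (norm_axis Δ lam z i) (norm_axis Δ lam z j))
  have hpos := bound_pos hD
  have e : |(conj (axis Δ lam z i) * axis Δ lam z j).im| =
      |(conj (dir Δ (opp j)) * dir Δ (opp i)).im| := by
    have h1 : axis Δ lam z i * dir Δ (opp i) = axis Δ lam z j * dir Δ (opp j) := by
      rw [axis_mul_dir, axis_mul_dir]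
    have h2 : ∀ w : ℂ, ‖w‖ = 1 → conj w * w = 1 := fun w hw => by
      rw [Complex.conj_mul', hw]; simp
    have h3 := h2 _ (norm_dir Δ (opp j))
    have h4 := h2 _ (norm_axis Δ lam z i)
    have h5 : conj (axis Δ lam z i) * axis Δ lam z j = conj (dir Δ (opp j)) * dir Δ (opp i) := by
      linear_combination (-conj (axis Δ lam z i) * axis Δ lam z j) * h3 -
        (conj (axis Δ lam z i) * conj (dir Δ (opp j))) * h1 +
        (conj (dir Δ (opp j)) * dir Δ (opp i)) * h4
    rw [h5]
  rw [e]
  have h1 : (2 / D ^ 2) ^ 2 ≤ |(conj (dir Δ (opp j)) * dir Δ (opp i)).im| ^ 2 := by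
    have := two_div_le_cross_dir hD hij.symm
    gcongr
  have h2 : 2 / D ^ 4 = (2 / D ^ 2) ^ 2 / 2 := by field_simp
  rw [h2]
  linarith

end Bounds

/-- The distance from a middle vertex to the first endpoint of its segment. -/
noncomputable def gapOne (Δ : UnitTriangle) (lam : Circle) (z : ℤ × ℤ) (i : Fin 3) : ℝ :=
  len Δ (opp (i + 2)) * |ratio Δ lam (z - corner (i + 1))|

/-- The distance from a middle vertex to the second endpoint of its segment. -/
noncomputable def gapTwo (Δ : UnitTriangle) (lam : Circle) (z : ℤ × ℤ) (i : Fin 3) : ℝ :=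
  len Δ (opp (i + 1)) * |ratio Δ lam (z - corner (i + 2))|

/-- The unit vector from a middle vertex to the first endpoint of its segment. -/
noncomputable def toward (Δ : UnitTriangle) (lam : Circle) (z : ℤ × ℤ) (i : Fin 3) : ℂ :=
  if 0 < ratio Δ lam (z - corner (i + 1)) then -axis Δ lam z i else axis Δ lam z i

theorem abs_ratio_le_one (Δ : UnitTriangle) (lam : Circle) (w : ℤ × ℤ) : |ratio Δ lam w| ≤ 1 := by
  refine (Complex.abs_re_le_norm _).trans ?_
  rw [norm_mul, norm_f, Circle.norm_coe, one_mul]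

theorem norm_toward (Δ : UnitTriangle) (lam : Circle) (z : ℤ × ℤ) (i : Fin 3) :
    ‖toward Δ lam z i‖ = 1 := by
  unfold toward; split_ifs <;> simp [norm_axis]

theorem inner_toward_sq (Δ : UnitTriangle) (lam : Circle) (z : ℤ × ℤ) (i : Fin 3) (n : ℂ) :
    inner ℝ n (toward Δ lam z i) ^ 2 = inner ℝ n (axis Δ lam z i) ^ 2 := by
  unfold toward
  split_ifs
  · rw [inner_neg_right, neg_sq]
  · rfl

theorem IsMid.psi_one {Δ : UnitTriangle} {lam : Circle} {z : ℤ × ℤ} {i : Fin 3}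
    (h : IsMid Δ lam z i) : psi Δ lam (z + corner i - corner (i + 1)) =
      psi Δ lam z + gapOne Δ lam z i * toward Δ lam z i := by
  rw [sub_eq_iff_eq_add.1 (psi_step_one Δ lam z i), gapOne, toward]
  rcases mul_pos_iff.1 h with ⟨p, q⟩ | ⟨p, q⟩
  · rw [if_pos p, abs_of_pos p]; push_cast; ring
  · rw [if_neg p.not_gt, abs_of_neg p]; push_cast; ring

theorem IsMid.psi_two {Δ : UnitTriangle} {lam : Circle} {z : ℤ × ℤ} {i : Fin 3}
    (h : IsMid Δ lam z i) : psi Δ lam (z + corner i - corner (i + 2)) =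
      psi Δ lam z - gapTwo Δ lam z i * toward Δ lam z i := by
  rw [sub_eq_iff_eq_add.1 (psi_step_two Δ lam z i), gapTwo, toward]
  rcases mul_pos_iff.1 h with ⟨p, q⟩ | ⟨p, q⟩
  · rw [if_pos p, abs_of_pos q]; push_cast; ring
  · rw [if_neg p.not_gt, abs_of_neg q]; push_cast; ring

/-! ### Walks along segments -/

/-- A Markov chain in the plane which jumps from each state to the two endpoints of a segment
containing it, at rates inverse to the distances. Such a chain is a martingale. The segments have
length at most `2 D`, and consecutive segments are uniformly transversal. All states at which one
of the two distances is less than `c` are small. At a small state one of the endpoints is at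
distance at least `c`; the other one is small too, and there the mean holding time is bounded below
by a multiple of the distance between the two states. -/
structure SegmentWalk {V : Type*} (pos : V → ℂ) (q : V → V → ℝ) (D c κ σ : ℝ) where
  /-- The first endpoint. -/
  fst : V → V
  /-- The second endpoint. -/
  snd : V → V
  /-- The distance to the first endpoint. -/
  gap₁ : V → ℝ
  /-- The distance to the second endpoint. -/
  gap₂ : V → ℝ
  /-- The direction of the first endpoint. -/
  axis : V → ℂ
  /-- The small states. -/
  small : V → Prop
  fst_ne_snd : ∀ v, fst v ≠ snd v
  rate_fst : ∀ v, q v (fst v) = 1 / gap₁ v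
  rate_snd : ∀ v, q v (snd v) = 1 / gap₂ v
  rate_other : ∀ v z, z ≠ fst v → z ≠ snd v → q v z = 0
  norm_axis : ∀ v, ‖axis v‖ = 1
  pos_fst : ∀ v, pos (fst v) = pos v + gap₁ v * axis v
  pos_snd : ∀ v, pos (snd v) = pos v - gap₂ v * axis v
  gap₁_pos : ∀ v, 0 < gap₁ v
  gap₂_pos : ∀ v, 0 < gap₂ v
  gap₁_le : ∀ v, gap₁ v ≤ D
  gap₂_le : ∀ v, gap₂ v ≤ D
  transversal_fst : ∀ v (n : ℂ), ‖n‖ = 1 →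
    σ ≤ inner ℝ n (axis v) ^ 2 + inner ℝ n (axis (fst v)) ^ 2
  transversal_snd : ∀ v (n : ℂ), ‖n‖ = 1 →
    σ ≤ inner ℝ n (axis v) ^ 2 + inner ℝ n (axis (snd v)) ^ 2
  gap_of_not_small : ∀ v, ¬ small v → c ≤ gap₁ v ∧ c ≤ gap₂ v
  gap_of_small : ∀ v, small v →
    (small (fst v) ∧ κ * gap₁ v ≤ gap₁ (fst v) ∧ κ * gap₁ v ≤ gap₂ (fst v) ∧ c ≤ gap₂ v) ∨
    (small (snd v) ∧ κ * gap₂ v ≤ gap₁ (snd v) ∧ κ * gap₂ v ≤ gap₂ (snd v) ∧ c ≤ gap₁ v)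

namespace SegmentWalk

variable {V : Type*} {pos : V → ℂ} {q : V → V → ℝ} {D c κ σ : ℝ}

open Classical in
/-- The possible targets of a jump. -/
noncomputable def targets (w : SegmentWalk pos q D c κ σ) (v : V) : Finset V := {w.fst v, w.snd v}

theorem rate_eq_zero (w : SegmentWalk pos q D c κ σ) (v z : V) (hz : z ∉ w.targets v) :
    q v z = 0 := by
  classical
  simp only [targets, Finset.mem_insert, Finset.mem_singleton, not_or] at hz
  exact w.rate_other v z hz.1 hz.2

theorem rate_nonneg (w : SegmentWalk pos q D c κ σ) (v z : V) : 0 ≤ q v z := by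
  by_cases h1 : z = w.fst v
  · rw [h1, w.rate_fst]; exact (one_div_pos.2 (w.gap₁_pos v)).le
  by_cases h2 : z = w.snd v
  · rw [h2, w.rate_snd]; exact (one_div_pos.2 (w.gap₂_pos v)).le
  rw [w.rate_other v z h1 h2]

theorem sum_targets (w : SegmentWalk pos q D c κ σ) (F : V → ℝ) (v : V) :
    ∑ z ∈ w.targets v, q v z * F z = F (w.fst v) / w.gap₁ v + F (w.snd v) / w.gap₂ v := by
  classical
  rw [targets, Finset.sum_pair (w.fst_ne_snd v), w.rate_fst, w.rate_snd]
  ring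

theorem exitRate_eq (w : SegmentWalk pos q D c κ σ) (v : V) :
    exitRate q v = 1 / w.gap₁ v + 1 / w.gap₂ v := by
  rw [exitRate_eq_sum w.rate_eq_zero, ← w.sum_targets (fun _ => 1)]
  simp

/-- One plus the squared distance to `x`; its square is a Lyapunov function. -/
noncomputable def norm2 (pos : V → ℂ) (x : ℂ) (v : V) : ℝ := 1 + ‖pos v - x‖ ^ 2

theorem one_le_norm2 (x : ℂ) (v : V) : 1 ≤ norm2 pos x v := by
  unfold norm2; linarith [sq_nonneg ‖pos v - x‖]

/-- The fourth power of the distance grows at most exponentially, since the length of the segments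
is bounded; the rates do not matter, by the martingale property. -/
theorem lyapunov (w : SegmentWalk pos q D c κ σ) (x : ℂ) (v : V) :
    ∑ z ∈ w.targets v, q v z * norm2 pos x z ^ 2 ≤
      (exitRate q v + (12 * D + 4 * D ^ 2 + 2 * D ^ 3)) * norm2 pos x v ^ 2 := by
  rw [w.sum_targets, w.exitRate_eq]
  have hd := w.gap₁_pos v
  have hd' := w.gap₂_pos v
  have hD := w.gap₁_le v
  have hD' := w.gap₂_le v
  set d := w.gap₁ v
  set d' := w.gap₂ v
  set U := norm2 pos x v with hU
  set p : ℝ := inner ℝ (pos v - x) (w.axis v) with hp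
  have hn := w.norm_axis v
  have e1 : norm2 pos x (w.fst v) = U + (2 * d * p + d ^ 2) := by
    rw [hU, norm2, norm2, w.pos_fst, show pos v + d * w.axis v - x =
      (pos v - x) + d • w.axis v by rw [Complex.real_smul]; ring, norm_add_sq_real,
      inner_smul_right, norm_smul, hn, Real.norm_of_nonneg hd.le]
    ring
  have e2 : norm2 pos x (w.snd v) = U + (-(2 * d' * p) + d' ^ 2) := by
    rw [hU, norm2, norm2, w.pos_snd, show pos v - d' * w.axis v - x =
      (pos v - x) - d' • w.axis v by rw [Complex.real_smul]; ring, norm_sub_sq_real,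
      inner_smul_right, norm_smul, hn, Real.norm_of_nonneg hd'.le]
    ring
  have hU1 : 1 ≤ U := one_le_norm2 x v
  have hp2 : p ^ 2 ≤ U := by
    have h1 := abs_real_inner_le_norm (pos v - x) (w.axis v)
    rw [hn, mul_one, ← hp] at h1
    have h2 : |p| ^ 2 ≤ ‖pos v - x‖ ^ 2 := by gcongr
    rw [sq_abs] at h2
    rw [hU, norm2]; linarith
  have hUU : U ≤ U ^ 2 := by nlinarith
  have hpU : |p| ≤ U := by
    refine abs_le_of_sq_le_sq (by nlinarith) (by linarith)
  have key : (U + (2 * d * p + d ^ 2)) ^ 2 / d + (U + (-(2 * d' * p) + d' ^ 2)) ^ 2 / d' =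
      (1 / d + 1 / d') * U ^ 2 + (4 * (d + d') * p ^ 2 + 4 * p * (d ^ 2 - d' ^ 2) +
        2 * (d + d') * U + d ^ 3 + d' ^ 3) := by
    field_simp
    ring
  rw [e1, e2, key, add_mul]
  have hD0 : 0 < D := hd.trans_le hD
  have b1 : (d + d') * p ^ 2 ≤ (2 * D) * U ^ 2 := by
    refine mul_le_mul (by linarith) (hp2.trans hUU) (sq_nonneg p) (by linarith)
  have b2 : p * (d ^ 2 - d' ^ 2) ≤ U ^ 2 * D ^ 2 := by
    refine (le_abs_self _).trans ?_
    rw [abs_mul]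
    refine mul_le_mul (hpU.trans hUU) ?_ (abs_nonneg _) (by positivity)
    rw [abs_le]
    have h1 : d ^ 2 ≤ D ^ 2 := by gcongr
    have h2 : d' ^ 2 ≤ D ^ 2 := by gcongr
    constructor <;> nlinarith [sq_nonneg d, sq_nonneg d']
  have b3 : (d + d') * U ≤ (2 * D) * U ^ 2 :=
    mul_le_mul (by linarith) hUU (by linarith) (by linarith)
  have b4 : d ^ 3 + d' ^ 3 ≤ 2 * D ^ 3 * U ^ 2 := by
    have h1 : d ^ 3 ≤ D ^ 3 := by gcongr
    have h2 : d' ^ 3 ≤ D ^ 3 := by gcongr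
    have h3 : 2 * D ^ 3 * 1 ≤ 2 * D ^ 3 * U ^ 2 :=
      mul_le_mul_of_nonneg_left (by nlinarith) (by positivity)
    linarith
  nlinarith

theorem finite_norm2_le (hfin : ∀ R : ℝ, {v | ‖pos v‖ ≤ R}.Finite) (x : ℂ) (R : ℝ) :
    {v | norm2 pos x v ≤ R}.Finite := by
  refine (hfin (R + ‖x‖)).subset fun v hv => ?_
  have hv' : 1 + ‖pos v - x‖ ^ 2 ≤ R := hv
  have h1 : ‖pos v‖ ≤ ‖pos v - x‖ + ‖x‖ := by
    simpa using norm_add_le (pos v - x) x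
  have h2 := sq_nonneg (‖pos v - x‖ - 1)
  simp only [Set.mem_ofPred_eq]
  nlinarith [norm_nonneg (pos v - x)]

/-- The mean holding time of a state. -/
noncomputable def hold (w : SegmentWalk pos q D c κ σ) (v : V) : ℝ :=
  (1 / w.gap₁ v + 1 / w.gap₂ v)⁻¹

theorem hold_pos (w : SegmentWalk pos q D c κ σ) (v : V) : 0 < w.hold v := by
  have := w.gap₁_pos v
  have := w.gap₂_pos v
  unfold hold; positivity

theorem hold_mul (w : SegmentWalk pos q D c κ σ) (v : V) :
    w.hold v * (1 / w.gap₁ v + 1 / w.gap₂ v) = 1 := by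
  have := w.gap₁_pos v
  have := w.gap₂_pos v
  exact inv_mul_cancel₀ (by positivity)

theorem hold_le (w : SegmentWalk pos q D c κ σ) (v : V) : w.hold v ≤ D := by
  have h1 := w.gap₁_pos v
  have h2 := w.gap₂_pos v
  refine le_trans ?_ (w.gap₁_le v)
  rw [hold, inv_le_comm₀ (by positivity) h1, inv_eq_one_div]
  have := one_div_pos.2 h2
  linarith

theorem le_hold (w : SegmentWalk pos q D c κ σ) {v : V} {ρ : ℝ} (hρ : 0 < ρ)
    (h1 : ρ ≤ w.gap₁ v) (h2 : ρ ≤ w.gap₂ v) : ρ / 2 ≤ w.hold v := by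
  have p1 := w.gap₁_pos v
  have p2 := w.gap₂_pos v
  rw [hold, le_inv_comm₀ (by positivity) (by positivity)]
  have := one_div_le_one_div_of_le hρ h1
  have := one_div_le_one_div_of_le hρ h2
  rw [inv_div, show (2 : ℝ) / ρ = 1 / ρ + 1 / ρ by ring]
  linarith

/-- The squared component of the direction of the segment at `v` along `n`. -/
noncomputable def comp (w : SegmentWalk pos q D c κ σ) (n : ℂ) (v : V) : ℝ :=
  inner ℝ n (w.axis v) ^ 2

open Classical in
/-- The indicator function of the small states. -/
noncomputable def ind (w : SegmentWalk pos q D c κ σ) (v : V) : ℝ := if w.small v then 1 else 0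

/-- The test function of the lower bound. The walk gains variance along `n` at rate proportional to
`comp`. The last term exploits that after a segment orthogonal to `n` comes one transversal to it,
on which the walk stays for the mean holding time. This is of no use if the walk gets close to a
small face, where the holding times are short; but there it runs quickly around the face many
times, and the term `B * ind` gives credit for getting there. -/
noncomputable def test (w : SegmentWalk pos q D c κ σ) (n : ℂ) (B K : ℝ) (v : V) : ℝ :=
  1 + B * w.ind v + K * (w.hold v * w.comp n v)

theorem comp_nonneg (w : SegmentWalk pos q D c κ σ) (n : ℂ) (v : V) : 0 ≤ w.comp n v := sq_nonneg _

theorem comp_le_one (w : SegmentWalk pos q D c κ σ) {n : ℂ} (hn : ‖n‖ = 1) (v : V) :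
    w.comp n v ≤ 1 := by
  have h := abs_real_inner_le_norm n (w.axis v)
  rw [hn, w.norm_axis, one_mul] at h
  rw [comp, ← sq_abs]
  exact pow_le_one₀ (abs_nonneg _) h

theorem ind_nonneg (w : SegmentWalk pos q D c κ σ) (v : V) : 0 ≤ w.ind v := by
  unfold ind; split_ifs <;> norm_num

theorem ind_le_one (w : SegmentWalk pos q D c κ σ) (v : V) : w.ind v ≤ 1 := by
  unfold ind; split_ifs <;> norm_num

theorem ind_of_small (w : SegmentWalk pos q D c κ σ) {v : V} (h : w.small v) : w.ind v = 1 :=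
  if_pos h

theorem ind_of_not_small (w : SegmentWalk pos q D c κ σ) {v : V} (h : ¬ w.small v) : w.ind v = 0 :=
  if_neg h

theorem one_le_test (w : SegmentWalk pos q D c κ σ) (n : ℂ) {B K : ℝ} (hB : 0 ≤ B) (hK : 0 ≤ K)
    (v : V) : 1 ≤ w.test n B K v := by
  have h1 := mul_nonneg hB (w.ind_nonneg v)
  have h2 := mul_nonneg hK (mul_nonneg (w.hold_pos v).le (w.comp_nonneg n v))
  unfold test; linarith

theorem test_le (w : SegmentWalk pos q D c κ σ) {n : ℂ} (hn : ‖n‖ = 1) {B K : ℝ} (hB : 0 ≤ B)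
    (hK : 0 ≤ K) (v : V) : w.test n B K v ≤ 1 + B + K * D := by
  have h1 := mul_le_mul_of_nonneg_left (w.ind_le_one v) hB
  have hD : 0 ≤ D := (w.gap₁_pos v).le.trans (w.gap₁_le v)
  have h2 : w.hold v * w.comp n v ≤ D * 1 :=
    mul_le_mul (w.hold_le v) (w.comp_le_one hn v) (w.comp_nonneg n v) hD
  have h3 := mul_le_mul_of_nonneg_left h2 hK
  unfold test; linarith

/-- The test function is a subsolution up to a multiple of the rate of variance. -/
theorem test_subsolution (w : SegmentWalk pos q D c κ σ) {n : ℂ} (hn : ‖n‖ = 1) {κ' μ K : ℝ}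
    (hc : 0 < c) (hκ' : 0 < κ') (h1 : κ' ≤ κ / 2) (h2 : κ' ≤ c / (2 * D)) (hμ : 0 ≤ μ)
    (hK : K * (κ' * σ) = μ + μ * (μ * D) + μ * D / c) (hK0 : 0 ≤ K) (v : V) :
    μ * w.test n (μ * D) K v ≤
      (w.test n (μ * D) K (w.fst v) - w.test n (μ * D) K v) / w.gap₁ v +
      (w.test n (μ * D) K (w.snd v) - w.test n (μ * D) K v) / w.gap₂ v +
      K * (1 + κ' + μ * D) * w.comp n v := by
  have p1 := w.gap₁_pos v
  have p2 := w.gap₂_pos v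
  have D1 := w.gap₁_le v
  have D2 := w.gap₂_le v
  have hD : 0 < D := p1.trans_le D1
  have hm := w.hold_mul v
  have hQ := w.comp_nonneg n v
  have hκ : 0 < κ := by linarith
  -- a neighbour at which the walk stays long enough
  have good : ∀ z g, 0 < g → σ ≤ w.comp n v + w.comp n z → κ' * g ≤ w.hold z →
      κ' * (σ - w.comp n v) ≤ w.hold z * w.comp n z / g := by
    intro z g hg hσ hh
    rw [le_div_iff₀ hg]
    have e1 : κ' * (σ - w.comp n v) ≤ κ' * w.comp n z :=
      mul_le_mul_of_nonneg_left (by linarith) hκ'.le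
    have e2 := mul_le_mul_of_nonneg_right e1 hg.le
    have e3 := mul_le_mul_of_nonneg_right hh (w.comp_nonneg n z)
    nlinarith
  have t1 := w.transversal_fst v n hn
  have t2 := w.transversal_snd v n hn
  have q1 : 0 ≤ w.hold (w.fst v) * w.comp n (w.fst v) / w.gap₁ v :=
    div_nonneg (mul_nonneg (w.hold_pos _).le (w.comp_nonneg _ _)) p1.le
  have q2 : 0 ≤ w.hold (w.snd v) * w.comp n (w.snd v) / w.gap₂ v :=
    div_nonneg (mul_nonneg (w.hold_pos _).le (w.comp_nonneg _ _)) p2.le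
  have s1 := w.ind_nonneg (w.fst v)
  have s2 := w.ind_nonneg (w.snd v)
  -- the generator applied to the test function
  have gen : (w.test n (μ * D) K (w.fst v) - w.test n (μ * D) K v) / w.gap₁ v +
      (w.test n (μ * D) K (w.snd v) - w.test n (μ * D) K v) / w.gap₂ v =
      μ * D * ((w.ind (w.fst v) - w.ind v) / w.gap₁ v + (w.ind (w.snd v) - w.ind v) / w.gap₂ v) +
      K * (w.hold (w.fst v) * w.comp n (w.fst v) / w.gap₁ v +
        w.hold (w.snd v) * w.comp n (w.snd v) / w.gap₂ v - w.comp n v) := by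
    have e : w.comp n v = w.comp n v * (w.hold v * (1 / w.gap₁ v + 1 / w.gap₂ v)) := by
      rw [hm, mul_one]
    rw [show K * (w.hold (w.fst v) * w.comp n (w.fst v) / w.gap₁ v +
        w.hold (w.snd v) * w.comp n (w.snd v) / w.gap₂ v - w.comp n v) =
        K * (w.hold (w.fst v) * w.comp n (w.fst v) / w.gap₁ v +
        w.hold (w.snd v) * w.comp n (w.snd v) / w.gap₂ v -
        w.comp n v * (w.hold v * (1 / w.gap₁ v + 1 / w.gap₂ v))) by rw [← e]]
    simp only [test]
    ring
  rw [gen]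
  have hhold : K * μ * (w.hold v * w.comp n v) ≤ K * μ * (D * w.comp n v) :=
    mul_le_mul_of_nonneg_left (mul_le_mul_of_nonneg_right (w.hold_le v) hQ) (mul_nonneg hK0 hμ)
  have hμD := mul_nonneg hμ hD.le
  have hr1 : 0 ≤ μ * (μ * D) := mul_nonneg hμ hμD
  have hr2 : 0 ≤ μ * D / c := div_nonneg hμD hc.le
  rw [test]
  set X := w.hold (w.fst v) * w.comp n (w.fst v) / w.gap₁ v +
    w.hold (w.snd v) * w.comp n (w.snd v) / w.gap₂ v with hX
  by_cases hv : w.small v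
  · rw [w.ind_of_small hv]
    -- the loss of the credit `B` happens at bounded rate, through the far endpoint
    have main : κ' * (σ - w.comp n v) ≤ X ∧
        -(1 / c) ≤ (w.ind (w.fst v) - 1) / w.gap₁ v + (w.ind (w.snd v) - 1) / w.gap₂ v := by
      rcases w.gap_of_small v hv with ⟨hs, g1, g2, g3⟩ | ⟨hs, g1, g2, g3⟩
      · constructor
        · refine (good (w.fst v) _ p1 t1 ?_).trans (le_add_of_nonneg_right q2)
          refine le_trans ?_ (w.le_hold (mul_pos hκ p1) g1 g2)
          have := mul_le_mul_of_nonneg_right h1 p1.le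
          linarith
        · rw [w.ind_of_small hs, sub_self, zero_div, zero_add]
          have e1 := one_div_le_one_div_of_le hc g3
          have e2 : -(1 / w.gap₂ v) ≤ (w.ind (w.snd v) - 1) / w.gap₂ v := by
            rw [← neg_div]; gcongr; linarith
          linarith
      · constructor
        · refine (good (w.snd v) _ p2 t2 ?_).trans (le_add_of_nonneg_left q1)
          refine le_trans ?_ (w.le_hold (mul_pos hκ p2) g1 g2)
          have := mul_le_mul_of_nonneg_right h1 p2.le
          linarith
        · rw [w.ind_of_small hs, sub_self, zero_div, add_zero]
          have e1 := one_div_le_one_div_of_le hc g3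
          have e2 : -(1 / w.gap₁ v) ≤ (w.ind (w.fst v) - 1) / w.gap₁ v := by
            rw [← neg_div]; gcongr; linarith
          linarith
    have m1 := mul_le_mul_of_nonneg_left main.1 hK0
    have m2 := mul_le_mul_of_nonneg_left main.2 hμD
    rw [mul_neg, mul_one_div] at m2
    linarith
  · rw [w.ind_of_not_small hv]
    have hg := w.gap_of_not_small v hv
    by_cases hz : w.small (w.fst v)
    · have e1 : 1 / D ≤ (w.ind (w.fst v) - 0) / w.gap₁ v := by
        rw [w.ind_of_small hz, sub_zero]; exact one_div_le_one_div_of_le p1 D1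
      have e2 : 0 ≤ (w.ind (w.snd v) - 0) / w.gap₂ v := by
        rw [sub_zero]; exact div_nonneg s2 p2.le
      have e3 := mul_le_mul_of_nonneg_left (add_le_add e1 e2) hμD
      rw [add_zero, mul_one_div, mul_div_cancel_right₀ _ hD.ne'] at e3
      have e4 : 0 ≤ K * X := mul_nonneg hK0 (add_nonneg q1 q2)
      have e5 := mul_nonneg hK0 (mul_nonneg hκ'.le hQ)
      linarith
    · have hg' := w.gap_of_not_small _ hz
      have e1 : 0 ≤ (w.ind (w.fst v) - 0) / w.gap₁ v + (w.ind (w.snd v) - 0) / w.gap₂ v := by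
        rw [sub_zero, sub_zero]; exact add_nonneg (div_nonneg s1 p1.le) (div_nonneg s2 p2.le)
      have e2 := mul_nonneg hμD e1
      have e3 : κ' * (σ - w.comp n v) ≤ X := by
        refine (good (w.fst v) _ p1 t1 ?_).trans (le_add_of_nonneg_right q2)
        refine le_trans ?_ (w.le_hold hc hg'.1 hg'.2)
        calc κ' * w.gap₁ v ≤ c / (2 * D) * D := by gcongr
          _ = c / 2 := by field_simp
      have m1 := mul_le_mul_of_nonneg_left e3 hK0
      linarith

theorem le_gap_add (w : SegmentWalk pos q D c κ σ) (v : V) : c ≤ w.gap₁ v + w.gap₂ v := by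
  have h1 := w.gap₁_pos v
  have h2 := w.gap₂_pos v
  by_cases hv : w.small v
  · rcases w.gap_of_small v hv with ⟨-, -, -, g⟩ | ⟨-, -, -, g⟩ <;> linarith
  · linarith [(w.gap_of_not_small v hv).1]

/-- Along `n`, the squared distance to any level grows at rate `(gap₁ + gap₂) * comp`. -/
theorem generator_sq (w : SegmentWalk pos q D c κ σ) (n : ℂ) (y : ℝ) (v : V) :
    ((inner ℝ n (pos (w.fst v)) - y) ^ 2 - (inner ℝ n (pos v) - y) ^ 2) / w.gap₁ v +
      ((inner ℝ n (pos (w.snd v)) - y) ^ 2 - (inner ℝ n (pos v) - y) ^ 2) / w.gap₂ v =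
      (w.gap₁ v + w.gap₂ v) * w.comp n v := by
  have h1 := (w.gap₁_pos v).ne'
  have h2 := (w.gap₂_pos v).ne'
  rw [w.pos_fst, w.pos_snd, ← Complex.real_smul, ← Complex.real_smul, inner_add_right,
    inner_sub_right, inner_smul_right, inner_smul_right, comp]
  field_simp
  ring

theorem exists_exp_gt (a b : ℝ) (ha : 0 ≤ a) (hb : 0 ≤ b) :
    ∃ μ : ℝ, 0 < μ ∧ 1 + a * μ + b * μ ^ 2 < Real.exp μ := by
  refine ⟨12 * (1 + a + b), by positivity, ?_⟩
  set μ := 12 * (1 + a + b) with hμ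
  have hμ1 : 1 ≤ μ := by linarith
  have h := Real.pow_div_factorial_le_exp μ (by linarith) 3
  have h6 : ((Nat.factorial 3 : ℕ) : ℝ) = 6 := by norm_num [Nat.factorial]
  rw [h6] at h
  have h1 : 1 + a * μ + b * μ ^ 2 ≤ (1 + a + b) * μ ^ 2 := by nlinarith
  have h2 : (1 + a + b) * μ ^ 2 = μ ^ 3 / 12 := by rw [hμ]; ring
  have h3 : 0 < μ ^ 3 := by positivity
  linarith

/-- Uniform lower bound for the second moments of the walk at time one, about any value. -/
theorem exists_le_second_moment (hD : 0 < D) (hc : 0 < c) (hκ : 0 < κ) (hσ : 0 < σ) :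
    ∃ ε : ℝ, 0 < ε ∧ ∀ {V : Type} [Countable V] {pos : V → ℂ} {q : V → V → ℝ}
      (_ : SegmentWalk pos q D c κ σ) (_ : ∀ R : ℝ, {v | ‖pos v‖ ≤ R}.Finite) (v : V) (n : ℂ)
      (_ : ‖n‖ = 1) (y : ℝ), ENNReal.ofReal ε ≤
        ∑' z, transitionProb q 1 v z * ENNReal.ofReal ((inner ℝ n (pos z) - y) ^ 2) := by
  set κ' := min (κ / 2) (c / (2 * D)) with hκ'
  have hκ0 : 0 < κ' := lt_min (by positivity) (by positivity)
  obtain ⟨μ, hμ, hexp⟩ := exists_exp_gt (D + (1 + D / c) / (κ' * σ) * D) (D / (κ' * σ) * D)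
    (by positivity) (by positivity)
  set K := (μ + μ * (μ * D) + μ * D / c) / (κ' * σ) with hK
  have hK0 : 0 ≤ K := by positivity
  set M := 1 + μ * D + K * D with hM
  have hMexp : M < Real.exp μ := by
    refine lt_of_eq_of_lt ?_ hexp
    rw [hM, hK]; field_simp; ring
  set C := K * (1 + κ' + μ * D) with hC
  have hC0 : 0 ≤ C := by positivity
  set θ := c / (Real.exp μ * C + 1) with hθ
  have hθ0 : 0 < θ := by positivity
  have hθC : θ * (Real.exp μ * C) ≤ c := by
    rw [hθ, div_mul_eq_mul_div, div_le_iff₀ (by positivity)]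
    have := Real.exp_pos μ
    nlinarith
  refine ⟨θ * (Real.exp μ - M), mul_pos hθ0 (sub_pos.2 hMexp), ?_⟩
  intro V _ pos q w hfin v n hn y
  have hM1 : ∀ z, 1 ≤ w.test n (μ * D) K z := w.one_le_test n (by positivity) hK0
  have hM2 : ∀ z, w.test n (μ * D) K z ≤ M := w.test_le hn (by positivity) hK0
  have hex : ∀ t ∈ Set.Icc (0 : ℝ) 1, Real.exp (μ * t) ≤ Real.exp μ := fun t ht =>
    Real.exp_le_exp.2 (by nlinarith [ht.2])
  have h := subsolution_le_tsum (q := q) (S := w.targets) w.rate_nonneg w.rate_eq_zero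
    (U := norm2 pos 0) (one_le_norm2 0) (finite_norm2_le hfin 0)
    (C := 12 * D + 4 * D ^ 2 + 2 * D ^ 3) (by positivity) (w.lyapunov 0)
    (A := fun z => (inner ℝ n (pos z) - y) ^ 2 - θ * M) (φ := fun z => θ * w.test n (μ * D) K z)
    (μ := μ) (T := 1) (a := 2 + 2 * y ^ 2 + θ * M * Real.exp μ) (by positivity) ?_ ?_
    (h := fun z => ENNReal.ofReal ((inner ℝ n (pos z) - y) ^ 2)) ?_ ⟨zero_le_one, le_rfl⟩ v
  · refine le_trans (ENNReal.ofReal_le_ofReal ?_) h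
    have h1 := mul_le_mul_of_nonneg_left (hM1 v) (mul_pos hθ0 (Real.exp_pos μ)).le
    have h2 := sq_nonneg (inner ℝ n (pos v) - y)
    rw [mul_one]
    nlinarith
  · intro t ht z
    have h1 := abs_real_inner_le_norm n (pos z)
    rw [hn, one_mul] at h1
    have h2 : inner ℝ n (pos z) ^ 2 ≤ ‖pos z‖ ^ 2 := by rw [← sq_abs]; gcongr
    have h3 : θ * w.test n (μ * D) K z * Real.exp (μ * t) ≤ θ * M * Real.exp μ := by
      exact mul_le_mul (mul_le_mul_of_nonneg_left (hM2 z) hθ0.le) (hex t ht) (Real.exp_pos _).le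
        (by positivity)
    have h4 : norm2 pos 0 z = 1 + ‖pos z‖ ^ 2 := by rw [norm2, sub_zero]
    have h5 : 0 ≤ θ * M := by positivity
    have h6 : 0 ≤ (2 * y ^ 2 + θ * M * Real.exp μ) * ‖pos z‖ ^ 2 := by positivity
    have h7 := sq_nonneg (inner ℝ n (pos z) + y)
    rw [h4]
    nlinarith
  · intro t ht z
    rw [w.sum_targets, w.exitRate_eq]
    have h1 := w.test_subsolution hn hc hκ0 (min_le_left _ _) (min_le_right _ _) hμ.le
      (div_mul_cancel₀ _ (by positivity)) hK0 z
    have h2 := w.generator_sq n y z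
    have h3 := mul_le_mul_of_nonneg_right (w.le_gap_add z) (w.comp_nonneg n z)
    have h4 : θ * (Real.exp (μ * t) * C) ≤ c :=
      le_trans
      (mul_le_mul_of_nonneg_left (mul_le_mul_of_nonneg_right (hex t ht) hC0) hθ0.le) hθC
    have h5 := mul_le_mul_of_nonneg_right h4 (w.comp_nonneg n z)
    have h6 := mul_le_mul_of_nonneg_left h1 (mul_pos hθ0 (Real.exp_pos (μ * t))).le
    have p1 := (w.gap₁_pos z).ne'
    have p2 := (w.gap₂_pos z).ne'
    rw [← sub_nonneg]
    refine le_of_le_of_eq (b := (w.gap₁ z + w.gap₂ z) * w.comp n z + θ * Real.exp (μ * t) *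
      ((w.test n (μ * D) K (w.fst z) - w.test n (μ * D) K z) / w.gap₁ z +
      (w.test n (μ * D) K (w.snd z) - w.test n (μ * D) K z) / w.gap₂ z) -
      θ * Real.exp (μ * t) * (μ * w.test n (μ * D) K z)) ?_ ?_
    · nlinarith
    · rw [← h2]; ring
  · intro z
    refine ENNReal.ofReal_le_ofReal ?_
    nlinarith [hM2 z]

theorem tsum_eq_one [Countable V] (w : SegmentWalk pos q D c κ σ)
    (hfin : ∀ R : ℝ, {v | ‖pos v‖ ≤ R}.Finite) (hD : 0 < D) {t : ℝ} (ht : 0 ≤ t) (v : V) :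
    ∑' z, transitionProb q t v z = 1 :=
  tsum_transitionProb_eq_one w.rate_nonneg w.rate_eq_zero (one_le_norm2 0) (finite_norm2_le hfin 0)
    (C := 12 * D + 4 * D ^ 2 + 2 * D ^ 3) (by positivity) (w.lyapunov 0) ht v

/-- Uniform upper bound for the second moment of the displacement. -/
theorem second_moment_le [Countable V] (w : SegmentWalk pos q D c κ σ) (hD : 0 < D) {t : ℝ}
    (ht : 0 ≤ t) (v : V) {n : ℂ} (hn : ‖n‖ = 1) :
    ∑' z, transitionProb q t v z * ENNReal.ofReal ((inner ℝ n (pos z) - inner ℝ n (pos v)) ^ 2) ≤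
      ENNReal.ofReal (Real.exp ((12 * D + 4 * D ^ 2 + 2 * D ^ 3) * t)) := by
  have h := tsum_transitionProb_mul_le w.rate_nonneg w.rate_eq_zero
    (W := fun z => norm2 pos (pos v) z ^ 2) (fun z => sq_nonneg _)
    (C := 12 * D + 4 * D ^ 2 + 2 * D ^ 3) (by positivity) (w.lyapunov (pos v)) ht v
  have h1 : norm2 pos (pos v) v = 1 := by simp [norm2]
  rw [h1, one_pow, one_mul] at h
  refine le_trans (ENNReal.tsum_le_tsum fun z => ?_) h
  refine mul_le_mul_right (ENNReal.ofReal_le_ofReal ?_) _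
  have h2 := abs_real_inner_le_norm n (pos z - pos v)
  rw [hn, one_mul] at h2
  rw [← inner_sub_right, ← sq_abs (inner ℝ n _)]
  have h3 : |inner ℝ n (pos z - pos v)| ^ 2 ≤ ‖pos z - pos v‖ ^ 2 := by gcongr
  have h4 := one_le_norm2 (pos := pos) (pos v) z
  have h5 : norm2 pos (pos v) z = 1 + ‖pos z - pos v‖ ^ 2 := rfl
  nlinarith

end SegmentWalk

/-! ### The walk on the T-graph -/

theorem IsInterior.symm {Δ : UnitTriangle} {lam : Circle} {b : ℤ × ℤ} {x y v : ℂ}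
    (h : IsInterior Δ lam b x y v) : IsInterior Δ lam b y x v :=
  ⟨h.1.symm, by rw [segment_symm]; exact h.2.1, by rw [openSegment_symm]; exact h.2.2⟩

section Gaps

variable {Δ : UnitTriangle} {D : ℝ} {lam : Circle} {z : ℤ × ℤ} {i : Fin 3}

theorem le_gap (hD : ∀ e, len Δ e ≤ D) {ρ : ℝ} (h0ρ : 0 ≤ ρ)
    (hρ : ∀ k, ρ ≤ |ratio Δ lam (z - corner k)|) :
    2 / D * ρ ≤ gapOne Δ lam z i ∧ 2 / D * ρ ≤ gapTwo Δ lam z i := by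
  exact ⟨mul_le_mul (two_div_le_len hD _) (hρ _) h0ρ (len_pos _ _).le,
    mul_le_mul (two_div_le_len hD _) (hρ _) h0ρ (len_pos _ _).le⟩

theorem gap_le (hD : ∀ e, len Δ e ≤ D) :
    gapOne Δ lam z i ≤ D ∧ gapTwo Δ lam z i ≤ D := by
  have h0 := (bound_pos hD).le
  have key : ∀ e w, len Δ e * |ratio Δ lam w| ≤ D := fun e w => by
    have := mul_le_mul (hD e) (abs_ratio_le_one Δ lam w) (abs_nonneg _) h0
    linarith
  exact ⟨key _ _, key _ _⟩

theorem gap_pos (h : Nondegenerate Δ lam) : 0 < gapOne Δ lam z i ∧ 0 < gapTwo Δ lam z i :=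
  ⟨mul_pos (len_pos _ _) (abs_pos.2 (ratio_ne_zero h _)),
    mul_pos (len_pos _ _) (abs_pos.2 (ratio_ne_zero h _))⟩

theorem four_div_le (hD : ∀ e, len Δ e ≤ D) : 4 / D ^ 4 ≤ 2 / D ^ 2 := by
  have h0 := bound_pos hD
  have h2 := two_le_bound_sq hD
  rw [div_le_div_iff₀ (by positivity) (by positivity)]
  nlinarith [pow_pos h0 2]

/-- The faces at a vertex other than a small one are not small. -/
theorem le_abs_ratio_of_ne (hD : ∀ e, len Δ e ≤ D) {k j : Fin 3} (hkj : k ≠ j)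
    (hk : |ratio Δ lam (z - corner k)| < 2 / D ^ 4) :
    2 / D ^ 4 ≤ |ratio Δ lam (z - corner j)| := by
  have h1 := two_div_le_abs_ratio_add hD lam z hkj
  have h2 := four_div_le hD
  have h3 : 4 / D ^ 4 = 2 / D ^ 4 + 2 / D ^ 4 := by ring
  linarith

/-- A small face at a vertex is adjacent to the segment whose interior contains the vertex: the
weighted ratio of the third face is the sum of those of the two adjacent faces, which are not both
small. -/
theorem IsMid.ne_of_small (hD : ∀ e, len Δ e ≤ D) (hm : IsMid Δ lam z i) {k : Fin 3}
    (hk : |ratio Δ lam (z - corner k)| < 2 / D ^ 4) : k ≠ i := by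
  rintro rfl
  have h0 := bound_pos hD
  have hsum := sum_len_mul_ratio Δ lam z
  have e : len Δ (opp k) * ratio Δ lam (z - corner k) =
      -(len Δ (opp (k + 1)) * ratio Δ lam (z - corner (k + 1)) +
        len Δ (opp (k + 2)) * ratio Δ lam (z - corner (k + 2))) := by
    rw [Fin.sum_univ_three] at hsum
    fin_cases k <;> simp at * <;> linarith
  have h1 : len Δ (opp k) * |ratio Δ lam (z - corner k)| =
      len Δ (opp (k + 1)) * |ratio Δ lam (z - corner (k + 1))| +
        len Δ (opp (k + 2)) * |ratio Δ lam (z - corner (k + 2))| := by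
    rw [← abs_of_pos (len_pos Δ (opp k)), ← abs_mul, e, abs_neg]
    rcases mul_pos_iff.1 hm with ⟨p, q⟩ | ⟨p, q⟩
    · rw [abs_of_pos p, abs_of_pos q, abs_of_pos]
      exact add_pos (mul_pos (len_pos _ _) p) (mul_pos (len_pos _ _) q)
    · rw [abs_of_neg p, abs_of_neg q, abs_of_neg]
      · ring
      · exact add_neg (mul_neg_of_pos_of_neg (len_pos _ _) p)
          (mul_neg_of_pos_of_neg (len_pos _ _) q)
  have hne : k + 1 ≠ k + 2 := by clear * -; revert k; decide
  have h2 := two_div_le_abs_ratio_add hD lam z hne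
  have h3 := mul_le_mul_of_nonneg_right (two_div_le_len hD (k + 1))
    (abs_nonneg (ratio Δ lam (z - corner (k + 1))))
  have h4 := mul_le_mul_of_nonneg_right (two_div_le_len hD (k + 2))
    (abs_nonneg (ratio Δ lam (z - corner (k + 2))))
  have h5 := mul_le_mul_of_nonneg_left h2 (show 0 ≤ 2 / D by positivity)
  have h6 : len Δ (opp k) * |ratio Δ lam (z - corner k)| ≤ D * (2 / D ^ 4) :=
    mul_le_mul (hD _) hk.le (abs_nonneg _) h0.le
  have h7 : D * (2 / D ^ 4) < 2 / D * (2 / D ^ 2) := by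
    have e1 : D * (2 / D ^ 4) = 2 / D ^ 3 := by field_simp
    have e2 : 2 / D * (2 / D ^ 2) = 4 / D ^ 3 := by field_simp; norm_num
    rw [e1, e2]
    gcongr
    norm_num
  linarith

theorem le_gap_of_small (hD : ∀ e, len Δ e ≤ D) {k : Fin 3}
    (hk : |ratio Δ lam (z - corner k)| < 2 / D ^ 4) :
    2 / D * |ratio Δ lam (z - corner k)| ≤ gapOne Δ lam z i ∧
      2 / D * |ratio Δ lam (z - corner k)| ≤ gapTwo Δ lam z i := by
  refine le_gap hD (abs_nonneg _) fun j => ?_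
  by_cases hkj : k = j
  · rw [hkj]
  · exact hk.le.trans (le_abs_ratio_of_ne hD hkj hk)

theorem two_div_sq_mul_le (hD : ∀ e, len Δ e ≤ D) (e : EdgeKind) (r : ℝ) :
    2 / D ^ 2 * (len Δ e * |r|) ≤ 2 / D * |r| := by
  have h0 := bound_pos hD
  have h1 := mul_le_mul_of_nonneg_right (hD e) (abs_nonneg r)
  calc 2 / D ^ 2 * (len Δ e * |r|) ≤ 2 / D ^ 2 * (D * |r|) := by gcongr
    _ = _ := by field_simp

theorem four_div_le_len_mul (hD : ∀ e, len Δ e ≤ D) (i : Fin 3) {r : ℝ} (hr : 2 / D ^ 4 ≤ |r|) :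
    4 / D ^ 5 ≤ len Δ (opp i) * |r| := by
  have h0 := bound_pos hD
  have h1 : 4 / D ^ 5 = 2 / D * (2 / D ^ 4) := by field_simp; norm_num
  rw [h1]
  exact mul_le_mul (two_div_le_len hD i) hr (by positivity) (len_pos _ _).le

end Gaps

/-- The random walk on a non-degenerate T-graph, as a walk along segments. The small states are the
corners of faces of small contraction ratio. -/
theorem nonempty_segmentWalk {Δ : UnitTriangle} {lam : Circle} (h : Nondegenerate Δ lam) {D : ℝ}
    (hD : ∀ e, len Δ e ≤ D) :
    Nonempty (SegmentWalk (fun v : vertexSet Δ lam => (v : ℂ)) (walkRate Δ lam) D (4 / D ^ 5)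
      (2 / D ^ 2) (2 / D ^ 4)) := by
  have h0 := bound_pos hD
  choose idx hidx using fun v : vertexSet Δ lam => v.2
  choose mid hmid using fun v : vertexSet Δ lam => exists_isMid h (idx v)
  let vtx : ℤ × ℤ → vertexSet Δ lam := fun z => ⟨psi Δ lam z, z, rfl⟩
  have hvtx : ∀ z, idx (vtx z) = z := fun z => psi_injective h (hidx (vtx z))
  let n₁ : vertexSet Δ lam → ℤ × ℤ := fun v => idx v + corner (mid v) - corner (mid v + 1)
  let n₂ : vertexSet Δ lam → ℤ × ℤ := fun v => idx v + corner (mid v) - corner (mid v + 2)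
  have p₁ : ∀ v, ((vtx (n₁ v) : vertexSet Δ lam) : ℂ) =
      v + gapOne Δ lam (idx v) (mid v) * toward Δ lam (idx v) (mid v) := fun v => by
    rw [← hidx v]; exact (hmid v).psi_one
  have p₂ : ∀ v, ((vtx (n₂ v) : vertexSet Δ lam) : ℂ) =
      v - gapTwo Δ lam (idx v) (mid v) * toward Δ lam (idx v) (mid v) := fun v => by
    rw [← hidx v]; exact (hmid v).psi_two
  have hint : ∀ v : vertexSet Δ lam, IsInterior Δ lam (idx v + corner (mid v) - corner 1)
      (vtx (n₁ v)) (vtx (n₂ v)) v := fun v => by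
    have := (hmid v).isInterior
    rwa [hidx v] at this
  refine ⟨{
    fst := fun v => vtx (n₁ v)
    snd := fun v => vtx (n₂ v)
    gap₁ := fun v => gapOne Δ lam (idx v) (mid v)
    gap₂ := fun v => gapTwo Δ lam (idx v) (mid v)
    axis := fun v => toward Δ lam (idx v) (mid v)
    small := fun v => ∃ k, |ratio Δ lam (idx v - corner k)| < 2 / D ^ 4
    fst_ne_snd := fun v he => (hint v).1 (congrArg Subtype.val he)
    rate_fst := fun v => ?_
    rate_snd := fun v => ?_
    rate_other := fun v z h1 h2 => ?_
    norm_axis := fun v => norm_toward _ _ _ _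
    pos_fst := p₁
    pos_snd := p₂
    gap₁_pos := fun v => (gap_pos h).1
    gap₂_pos := fun v => (gap_pos h).2
    gap₁_le := fun v => (gap_le hD).1
    gap₂_le := fun v => (gap_le hD).2
    transversal_fst := fun v n hn => ?_
    transversal_snd := fun v n hn => ?_
    gap_of_not_small := fun v hv => ?_
    gap_of_small := fun v hv => ?_ }⟩
  · rw [walkRate, if_pos ⟨_, _, hint v⟩, p₁, add_sub_cancel_left, norm_mul, norm_toward, mul_one,
      Complex.norm_real, Real.norm_of_nonneg (gap_pos h).1.le]
  · rw [walkRate, if_pos ⟨_, _, (hint v).symm⟩, p₂, sub_sub_cancel_left, norm_neg, norm_mul,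
      norm_toward, mul_one, Complex.norm_real, Real.norm_of_nonneg (gap_pos h).2.le]
  · rw [walkRate, if_neg]
    rintro ⟨b, y, hb⟩
    rw [← hidx v] at hb
    rcases hb.eq_endpoints h (hmid v) with ⟨e, -⟩ | ⟨e, -⟩
    · exact h1 (Subtype.ext e)
    · exact h2 (Subtype.ext e)
  · rw [inner_toward_sq, inner_toward_sq, hvtx, ← axis_one]
    refine two_div_le_inner_axis hD lam _ (fun he => ?_) hn
    have := hmid (vtx (n₁ v))
    rw [hvtx, ← he] at this
    exact ((hmid v).not_isMid h).1 this
  · rw [inner_toward_sq, inner_toward_sq, hvtx, ← axis_two]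
    refine two_div_le_inner_axis hD lam _ (fun he => ?_) hn
    have := hmid (vtx (n₂ v))
    rw [hvtx, ← he] at this
    exact ((hmid v).not_isMid h).2 this
  · push Not at hv
    exact ⟨four_div_le_len_mul hD _ (hv _), four_div_le_len_mul hD _ (hv _)⟩
  · obtain ⟨k, hk⟩ := hv
    have hki := (hmid v).ne_of_small hD hk
    have hc : k = mid v + 1 ∨ k = mid v + 2 := by
      generalize mid v = i at hki
      clear * - hki
      revert k i
      decide
    have hne : mid v + 1 ≠ mid v + 2 := by
      generalize mid v = i
      clear * -
      revert i
      decide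
    rcases hc with rfl | rfl
    · left
      have e : n₁ v - corner (mid v) = idx v - corner (mid v + 1) := by simp only [n₁]; abel
      have hs := hk
      rw [← e] at hs
      have hg := le_gap_of_small (i := mid (vtx (n₁ v))) hD hs
      rw [hvtx]
      refine ⟨⟨mid v, hs⟩, le_trans ?_ hg.1, le_trans ?_ hg.2,
        four_div_le_len_mul hD _ (le_abs_ratio_of_ne hD hne hk)⟩ <;>
      · rw [e]; exact two_div_sq_mul_le hD _ _
    · right
      have e : n₂ v - corner (mid v) = idx v - corner (mid v + 2) := by simp only [n₂]; abel
      have hs := hk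
      rw [← e] at hs
      have hg := le_gap_of_small (i := mid (vtx (n₂ v))) hD hs
      rw [hvtx]
      refine ⟨⟨mid v, hs⟩, le_trans ?_ hg.1, le_trans ?_ hg.2,
        four_div_le_len_mul hD _ (le_abs_ratio_of_ne hD hne.symm hk)⟩ <;>
      · rw [e]; exact two_div_sq_mul_le hD _ _

theorem finite_norm_psi_le (Δ : UnitTriangle) (lam : Circle) (R : ℝ) :
    {z | ‖psi Δ lam z‖ ≤ R}.Finite := by
  set B := 2 * R + ‖osc Δ‖ * 2 with hB
  set N : ℤ := ⌈len Δ .vertical * B + len Δ .nwse * B⌉ with hN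
  refine ((Set.finite_Icc (-N) N).prod (Set.finite_Icc (-N) N)).subset fun z hz => ?_
  have hz' : ‖psi Δ lam z‖ ≤ R := hz
  have hl : ‖lattice Δ z‖ ≤ B := by
    have h1 := two_mul_psi Δ lam z
    have h2 : lattice Δ z = 2 * psi Δ lam z - (lam : ℂ) ^ 2 * osc Δ * (f Δ z ^ 2 - 1) := by
      rw [h1]; ring
    have h3 : ‖f Δ z ^ 2 - 1‖ ≤ 2 := by
      refine (norm_sub_le _ _).trans ?_
      rw [norm_pow, norm_f, one_pow, norm_one]; norm_num
    rw [h2]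
    refine (norm_sub_le _ _).trans ?_
    rw [norm_mul, norm_mul, norm_mul, norm_pow, Circle.norm_coe, one_pow, one_mul, Complex.norm_two]
    exact add_le_add (by linarith) (mul_le_mul_of_nonneg_left h3 (norm_nonneg _))
  have hcross : (conj (side Δ .nwse) * side Δ .vertical).im = 2 := cross_side Δ 1
  simp only [Complex.mul_im, Complex.conj_re, Complex.conj_im] at hcross
  have e1 : (conj (side Δ .nwse) * lattice Δ z).im = 2 * z.1 := by
    simp only [lattice, Complex.mul_im, Complex.mul_re, Complex.sub_im, Complex.sub_re,
      Complex.conj_re, Complex.conj_im, Complex.intCast_re, Complex.intCast_im]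
    linear_combination (z.1 : ℝ) * hcross
  have e2 : (conj (side Δ .vertical) * lattice Δ z).im = 2 * z.2 := by
    simp only [lattice, Complex.mul_im, Complex.mul_re, Complex.sub_im, Complex.sub_re,
      Complex.conj_re, Complex.conj_im, Complex.intCast_re, Complex.intCast_im]
    linear_combination (z.2 : ℝ) * hcross
  have h1 := Complex.abs_im_le_norm (conj (side Δ .nwse) * lattice Δ z)
  have h2 := Complex.abs_im_le_norm (conj (side Δ .vertical) * lattice Δ z)
  rw [e1, norm_mul, Complex.norm_conj] at h1
  rw [e2, norm_mul, Complex.norm_conj] at h2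
  have hc := (len_pos Δ .nwse).le
  have ha := (len_pos Δ .vertical).le
  have hB0 : 0 ≤ B := (norm_nonneg _).trans hl
  have m1 : len Δ .nwse * ‖lattice Δ z‖ ≤ len Δ .nwse * B := mul_le_mul_of_nonneg_left hl hc
  have m2 : len Δ .vertical * ‖lattice Δ z‖ ≤ len Δ .vertical * B := mul_le_mul_of_nonneg_left hl ha
  have k1 : 0 ≤ len Δ .nwse * B := mul_nonneg hc hB0
  have k2 : 0 ≤ len Δ .vertical * B := mul_nonneg ha hB0
  have hceil := Int.le_ceil (len Δ .vertical * B + len Δ .nwse * B)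
  rw [← hN] at hceil
  rw [abs_le] at h1 h2
  have h1' : len Δ .nwse = ‖side Δ .nwse‖ := rfl
  have h2' : len Δ .vertical = ‖side Δ .vertical‖ := rfl
  rw [← h1'] at h1
  rw [← h2'] at h2
  refine ⟨⟨?_, ?_⟩, ?_, ?_⟩ <;>
  · rify
    linarith

theorem lintegral_walkLaw (Δ : UnitTriangle) (lam : Circle) (x₀ : vertexSet Δ lam) (t : ℝ)
    (F : ℂ → ℝ≥0∞) : ∫⁻ x, F x ∂(walkLaw Δ lam x₀ t) =
      ∑' y : vertexSet Δ lam, transitionProb (walkRate Δ lam) t x₀ y * F y := by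
  rw [walkLaw, lintegral_sum_measure]
  simp [lintegral_smul_measure, lintegral_dirac]

/-- The bounds asserted of the walks on the T-graphs of a triangle. -/
def IsVarianceBound (Δ : UnitTriangle) (ε : ℝ) : Prop :=
  0 < ε ∧ ∀ lam : Circle, Nondegenerate Δ lam → ∀ x₀ : vertexSet Δ lam,
    IsProbabilityMeasure (walkLaw Δ lam x₀ 1) ∧ ∀ n : Circle,
      MemLp (fun x : ℂ => inner ℝ (n : ℂ) x) 2 (walkLaw Δ lam x₀ 1) ∧
      ε < variance (fun x : ℂ => inner ℝ (n : ℂ) x) (walkLaw Δ lam x₀ 1) ∧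
      variance (fun x : ℂ => inner ℝ (n : ℂ) x) (walkLaw Δ lam x₀ 1) < 1 / ε

/-- The bounds are uniform over the triangles with sides of length at most `D`. -/
theorem exists_isVarianceBound {D : ℝ} (hD : 0 < D) :
    ∃ ε, ∀ Δ : UnitTriangle, (∀ e, len Δ e ≤ D) → IsVarianceBound Δ ε := by
  obtain ⟨ε, hε, hlow⟩ := SegmentWalk.exists_le_second_moment (D := D) (c := 4 / D ^ 5)
    (κ := 2 / D ^ 2) (σ := 2 / D ^ 4) hD (by positivity) (by positivity) (by positivity)
  set C := Real.exp ((12 * D + 4 * D ^ 2 + 2 * D ^ 3) * 1) with hC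
  have hC0 : 0 < C := Real.exp_pos _
  refine ⟨min (ε / 2) (1 / (2 * C)), fun Δ hΔ => ⟨lt_min (by positivity) (by positivity), ?_⟩⟩
  intro lam hnd x₀
  obtain ⟨w⟩ := nonempty_segmentWalk hnd hΔ
  have : Countable (vertexSet Δ lam) := (Set.countable_range _).to_subtype
  have hfin : ∀ R : ℝ, {v : vertexSet Δ lam | ‖(v : ℂ)‖ ≤ R}.Finite := by
    intro R
    have h1 := ((finite_norm_psi_le Δ lam R).image (psi Δ lam)).preimage
      (f := (Subtype.val : vertexSet Δ lam → ℂ)) Subtype.val_injective.injOn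
    refine h1.subset ?_
    rintro ⟨_, z, rfl⟩ hv
    exact ⟨z, hv, rfl⟩
  have hprob : IsProbabilityMeasure (walkLaw Δ lam x₀ 1) := by
    constructor
    rw [← lintegral_one, lintegral_walkLaw]
    simpa using w.tsum_eq_one hfin hD zero_le_one x₀
  refine ⟨hprob, fun n => ?_⟩
  have hn : ‖(n : ℂ)‖ = 1 := Circle.norm_coe n
  set X : ℂ → ℝ := fun x => inner ℝ (n : ℂ) x with hX
  have hXm : Continuous X := by fun_prop
  set y₀ := X x₀ with hy₀
  have hup : ∫⁻ x, ENNReal.ofReal ((X x - y₀) ^ 2) ∂(walkLaw Δ lam x₀ 1) ≤ ENNReal.ofReal C := by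
    rw [lintegral_walkLaw]
    exact w.second_moment_le hD zero_le_one x₀ hn
  have hmem0 : MemLp (fun x => X x - y₀) 2 (walkLaw Δ lam x₀ 1) := by
    rw [memLp_two_iff_integrable_sq (by fun_prop)]
    refine ⟨by fun_prop, ?_⟩
    rw [hasFiniteIntegral_iff_ofReal (Filter.Eventually.of_forall fun x => sq_nonneg _)]
    exact hup.trans_lt ENNReal.ofReal_lt_top
  have hmem : MemLp X 2 (walkLaw Δ lam x₀ 1) := by
    have := hmem0.add (memLp_const (p := 2) (μ := walkLaw Δ lam x₀ 1) y₀)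
    refine this.congr_norm (by fun_prop) (Filter.Eventually.of_forall fun x => ?_)
    simp
  refine ⟨hmem, ?_, ?_⟩
  · refine (min_le_left _ _).trans_lt ((half_lt_self hε).trans_le ?_)
    rw [← ENNReal.ofReal_le_ofReal_iff (variance_nonneg _ _), ofReal_variance hmem,
      evariance_eq_lintegral_ofReal, lintegral_walkLaw]
    exact hlow w hfin x₀ n hn _
  · have h1 : variance X (walkLaw Δ lam x₀ 1) ≤ C := by
      rw [← variance_sub_const (by fun_prop) y₀]
      refine (variance_le_expectation_sq (by fun_prop)).trans ?_
      rw [← ENNReal.ofReal_le_ofReal_iff hC0.le, ofReal_integral_eq_lintegral_ofReal]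
      · exact hup
      · exact hmem0.integrable_sq
      · exact Filter.Eventually.of_forall fun x => sq_nonneg _
    have h2 : 2 * C ≤ 1 / min (ε / 2) (1 / (2 * C)) := by
      rw [le_one_div (by positivity) (lt_min (by positivity) (by positivity))]
      exact min_le_right _ _
    linarith

theorem continuous_len (e : EdgeKind) : Continuous fun Δ : UnitTriangle => len Δ e := by
  cases e <;> simp only [len, side] <;> fun_prop

theorem convex_setOf_isVarianceBound (Δ : UnitTriangle) : Convex ℝ {ε | IsVarianceBound Δ ε} := by
  refine Set.OrdConnected.convex ⟨fun a ha b hb c hc => ?_⟩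
  have hc0 : 0 < c := ha.1.trans_le hc.1
  refine ⟨hc0, fun lam h x₀ => ⟨(hb.2 lam h x₀).1, fun n => ?_⟩⟩
  obtain ⟨h1, h2, h3⟩ := (hb.2 lam h x₀).2 n
  exact ⟨h1, hc.2.trans_lt h2, h3.trans_le (one_div_le_one_div_of_le hc0 hc.2)⟩

end TGraph

theorem mainTheorem6 :
    ∃ ε : TGraph.UnitTriangle → ℝ, Continuous ε ∧ (∀ Δ, 0 < ε Δ) ∧
      ∀ (Δ : TGraph.UnitTriangle) (lam : Circle), TGraph.Nondegenerate Δ lam →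
        ∀ x₀ : TGraph.vertexSet Δ lam,
          IsProbabilityMeasure (TGraph.walkLaw Δ lam x₀ 1) ∧
          ∀ n : Circle,
            MemLp (fun x : ℂ => inner ℝ (n : ℂ) x) 2 (TGraph.walkLaw Δ lam x₀ 1) ∧
            ε Δ < variance (fun x : ℂ => inner ℝ (n : ℂ) x) (TGraph.walkLaw Δ lam x₀ 1) ∧
            variance (fun x : ℂ => inner ℝ (n : ℂ) x) (TGraph.walkLaw Δ lam x₀ 1) < 1 / ε Δ := by
  -- the constants depend on an upper bound for the side lengths only, hence can be chosen locally
  -- constant; a partition of unity makes them continuous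
  obtain ⟨ε, hε⟩ := exists_continuous_forall_mem_convex_of_local_const
    TGraph.convex_setOf_isVarianceBound fun Δ => by
      set D := TGraph.len Δ .vertical + TGraph.len Δ .nesw + TGraph.len Δ .nwse with hDdef
      have ha := TGraph.len_pos Δ .vertical
      have hb := TGraph.len_pos Δ .nesw
      have hc := TGraph.len_pos Δ .nwse
      obtain ⟨ε, hε⟩ := TGraph.exists_isVarianceBound (D := D) (by positivity)
      refine ⟨ε, ?_⟩
      have key : ∀ e, TGraph.len Δ e < D → ∀ᶠ Δ' in nhds Δ, TGraph.len Δ' e < D := fun e he =>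
        (TGraph.continuous_len e).continuousAt.eventually_lt continuousAt_const he
      filter_upwards [key .vertical (by linarith), key .nesw (by linarith),
        key .nwse (by linarith)] with Δ' h1 h2 h3
      exact hε Δ' fun e => by cases e <;> [exact h1.le; exact h2.le; exact h3.le]
  exact ⟨ε, ε.continuous, fun Δ => (hε Δ).1, fun Δ => (hε Δ).2⟩
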